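/- Let $(X,\sigma)$ be a Deaconu–Renault system: $X$ is a locally compact Hausdorff space and $\sigma\colon\operatorname{dom}(\sigma)\to\operatorname{ran}(\sigma)$ is a local homeomorphism between open subsets of $X$. Put $\operatorname{dom}(\sigma^0)=X$, $\operatorname{dom}(\sigma^{k+1})=\sigma^{-1}(\operatorname{dom}(\sigma^k))$. Let $$\mathcal G_X=\{(x,m-n,y): m,n\in\mathbb N,\ x\in\operatorname{dom}(\sigma^m),\ y\in\operatorname{dom}(\sigma^n),\ \sigma^m(x)=\sigma^n(y)\}$$ be the associated groupoid, with range map $(x,p,y)\mapsto x$, source map $(x,p,y)\mapsto y$, product $(x,p,y)(y,q,z)=(x,p+q,z)$, inverse $(x,p,y)^{-1}=(y,-p,x)$, and the topology generated by the sets $Z(U,m,n,V)=\{(x,m-n,y): x\in U,\ y\in V,\ x\in\operatorname{dom}(\sigma^m),\ y\in\operatorname{dom}(\sigma^n),\ \sigma^m(x)=\sigma^n(y)\}$ with $U,V\subseteq X$ open and $m,n\in\mathbb N$. Let $C^*(\mathcal G_X)$ be the reduced groupoid C*-algebra, that is, the completion of the convolution $*$-algebra $C_c(\mathcal G_X)$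 in the norm $\|\xi\|=\sup_{x\in X}\|\lambda_x(\xi)\|$, where $\lambda_x$ is the regular representation on $\ell^2(\{g\in\mathcal G_X: s(g)=x\})$ (the groupoid is amenable, so this is canonically isomorphic to the full groupoid C*-algebra). View $C_0(X)$ as a subalgebra of $C^*(\mathcal G_X)$ by identifying $x\in X$ with the unit $(x,0,x)$ and extending functions in $C_c(X)$ by zero. Let $\Gamma$ be a locally compact Hausdorff abelian group, written multiplicatively, with dual group $\widehat\Gamma$. Suppose that $\Gamma$ is separating for $X$: for every finite $F\subseteq X$ and every $x\in X\setminus F$ there is a continuous $f\colon X\to\Gamma$ such that $f(x)$ has infinite order and $f(y)=1$ for all $y\in F$. For $f\in C(X,\Gamma)$ let $\gamma^{X,f}\colon\widehat\Gamma\curvearrowright C^*(\mathcal G_X)$ be the weighted action, the action by $*$-automorphisms with $$\gamma^{X,f}_\chi(\xi)(x,m-n,y)=\chi\Big(\prod_{i=0}^{m-1}f(\sigma^i(x))\cdot\prod_{j=0}^{n-1}f(\sigma^j(y))^{-1}\Big)\,\xi(x,m-n,y)$$ for $\chi\in\widehat\Gamma$, $\xi\in C_c(\mathcal G_X)$ and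 $\sigma^m(x)=\sigma^n(y)$. Then $$C_0(X)=\bigcap_{f\in C(X,\Gamma)}\{a\in C^*(\mathcal G_X): \gamma^{X,f}_\chi(a)=a\text{ for all }\chi\in\widehat\Gamma\}.$$ -/

import Mathlib

open scoped Topology ZeroAtInfty CompactlySupported

noncomputable section

/-- The Hilbert space `ℓ²(ι)` of square-summable complex families. -/
abbrev EllTwo (ι : Type*) : Type _ := lp (fun _ : ι => ℂ) 2

namespace KernelOperator

variable {ι : Type*}

/-- A matrix `k : ι → ι → ℂ` with uniformly bounded entries and a uniform bound on the number of
nonzero entries in each row and each column. -/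
def IsBanded (k : ι → ι → ℂ) : Prop :=
  ∃ (N : ℕ) (C : ℝ), (∀ i, {j | k i j ≠ 0}.encard ≤ N) ∧ (∀ j, {i | k i j ≠ 0}.encard ≤ N) ∧
    ∀ i j, ‖k i j‖ ≤ C

theorem IsBanded.finite_row {k : ι → ι → ℂ} (hk : IsBanded k) (i : ι) : {j | k i j ≠ 0}.Finite := by
  obtain ⟨N, C, h, -, -⟩ := hk
  exact Set.finite_of_encard_le_coe (h i)

theorem IsBanded.finite_col {k : ι → ι → ℂ} (hk : IsBanded k) (j : ι) : {i | k i j ≠ 0}.Finite := by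
  obtain ⟨N, C, -, h, -⟩ := hk
  exact Set.finite_of_encard_le_coe (h j)

theorem IsBanded.tsum_eq {k : ι → ι → ℂ} (hk : IsBanded k) (v : ι → ℂ) (i : ι) :
    ∑' j, k i j * v j = ∑ j ∈ (hk.finite_row i).toFinset, k i j * v j := by
  refine tsum_eq_sum fun j hj => ?_
  have : k i j = 0 := by simpa using hj
  simp [this]

theorem IsBanded.exists_bound {k : ι → ι → ℂ} (hk : IsBanded k) :
    ∃ M : ℝ, 0 ≤ M ∧ ∀ (v : EllTwo ι) (s : Finset ι),
      ∑ i ∈ s, ‖∑' j, k i j * v j‖ ^ 2 ≤ (M * ‖v‖) ^ 2 := by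
  classical
  obtain ⟨N, C, hr, hc, hC⟩ := id hk
  refine ⟨N * |C|, by positivity, fun v s => ?_⟩
  set R : ι → Finset ι := fun i => (hk.finite_row i).toFinset with hR
  have hRc : ∀ i, ((R i).card : ℝ) ≤ N := fun i => by
    have := hr i
    rw [(hk.finite_row i).encard_eq_coe_toFinset_card] at this
    exact_mod_cast this
  have h1 : ∀ i, ‖∑' j, k i j * v j‖ ^ 2 ≤ N * |C| ^ 2 * ∑ j ∈ R i, ‖v j‖ ^ 2 := fun i => by
    rw [hk.tsum_eq]
    calc ‖∑ j ∈ R i, k i j * v j‖ ^ 2 ≤ (∑ j ∈ R i, |C| * ‖v j‖) ^ 2 := by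
          gcongr
          refine (norm_sum_le _ _).trans (Finset.sum_le_sum fun j _ => ?_)
          rw [norm_mul]
          gcongr
          exact (hC i j).trans (le_abs_self C)
      _ ≤ (R i).card * ∑ j ∈ R i, (|C| * ‖v j‖) ^ 2 := sq_sum_le_card_mul_sum_sq
      _ ≤ N * ∑ j ∈ R i, (|C| * ‖v j‖) ^ 2 := by
          gcongr
          exact_mod_cast hRc i
      _ = _ := by simp_rw [mul_pow, ← Finset.mul_sum, mul_assoc]
  have h2 : ∑ i ∈ s, ∑ j ∈ R i, ‖v j‖ ^ 2 ≤ N * ‖v‖ ^ 2 := by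
    set B := s.biUnion R with hB
    have e1 : ∑ i ∈ s, ∑ j ∈ R i, ‖v j‖ ^ 2 = ∑ i ∈ s, ∑ j ∈ B, if j ∈ R i then ‖v j‖ ^ 2 else 0 := by
      refine Finset.sum_congr rfl fun i hi => ?_
      rw [← Finset.sum_filter]
      refine Finset.sum_congr ?_ fun _ _ => rfl
      ext j
      simp only [Finset.mem_filter, hB, Finset.mem_biUnion]
      exact ⟨fun h => ⟨⟨i, hi, h⟩, h⟩, fun h => h.2⟩
    rw [e1, Finset.sum_comm]
    calc ∑ j ∈ B, ∑ i ∈ s, (if j ∈ R i then ‖v j‖ ^ 2 else 0) ≤ ∑ j ∈ B, N * ‖v j‖ ^ 2 := by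
          refine Finset.sum_le_sum fun j _ => ?_
          rw [← Finset.sum_filter, Finset.sum_const, nsmul_eq_mul]
          gcongr
          have h3 : ((s.filter fun i => j ∈ R i : Finset ι) : Set ι).encard ≤ N := by
            refine le_trans (Set.encard_le_encard ?_) (hc j)
            intro i hi
            simpa [hR] using (Finset.mem_filter.1 (Finset.mem_coe.1 hi)).2
          rw [Set.encard_coe_eq_coe_finsetCard] at h3
          exact_mod_cast h3
      _ = N * ∑ j ∈ B, ‖v j‖ ^ 2 := by rw [Finset.mul_sum]
      _ ≤ N * ‖v‖ ^ 2 := by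
          gcongr
          have := lp.sum_rpow_le_norm_rpow (p := 2) (by norm_num) v B
          simpa using this
  calc ∑ i ∈ s, ‖∑' j, k i j * v j‖ ^ 2 ≤ ∑ i ∈ s, N * |C| ^ 2 * ∑ j ∈ R i, ‖v j‖ ^ 2 :=
        Finset.sum_le_sum fun i _ => h1 i
    _ = N * |C| ^ 2 * ∑ i ∈ s, ∑ j ∈ R i, ‖v j‖ ^ 2 := by rw [Finset.mul_sum]
    _ ≤ N * |C| ^ 2 * (N * ‖v‖ ^ 2) := by gcongr
    _ = _ := by ring

/-- The bounded operator on `ℓ²(ι)` with matrix `k`, that is `(T v) i = ∑ j, k i j * v j`. -/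
def ofKernel (k : ι → ι → ℂ) (hk : IsBanded k) : EllTwo ι →L[ℂ] EllTwo ι :=
  LinearMap.mkContinuousOfExistsBound
    { toFun := fun v => ⟨fun i => ∑' j, k i j * v j, by
        obtain ⟨M, -, hM⟩ := hk.exists_bound
        exact memℓp_gen' (C := (M * ‖v‖) ^ 2) fun s => by simpa using hM v s⟩
      map_add' := fun v w => by
        refine lp.ext (funext fun i => ?_)
        change ∑' j, k i j * (v + w) j = ∑' j, k i j * v j + ∑' j, k i j * w j
        rw [hk.tsum_eq, hk.tsum_eq v, hk.tsum_eq w, ← Finset.sum_add_distrib]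
        exact Finset.sum_congr rfl fun j _ => by rw [lp.coeFn_add, Pi.add_apply, mul_add]
      map_smul' := fun c v => by
        refine lp.ext (funext fun i => ?_)
        change ∑' j, k i j * (c • v) j = c * ∑' j, k i j * v j
        rw [hk.tsum_eq, hk.tsum_eq v, Finset.mul_sum]
        refine Finset.sum_congr rfl fun j _ => ?_
        rw [lp.coeFn_smul, Pi.smul_apply, smul_eq_mul]
        ring }
    (by
      obtain ⟨M, hM0, hM⟩ := hk.exists_bound
      refine ⟨M, fun v => lp.norm_le_of_forall_sum_le (p := 2) (by norm_num) (by positivity) ?_⟩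
      intro s
      simpa using hM v s)

theorem ofKernel_apply (k : ι → ι → ℂ) (hk : IsBanded k) (v : EllTwo ι) (i : ι) :
    ofKernel k hk v i = ∑' j, k i j * v j := rfl

theorem ofKernel_congr {k l : ι → ι → ℂ} (hk : IsBanded k) (hl : IsBanded l)
    (h : ∀ i j, k i j = l i j) : ofKernel k hk = ofKernel l hl := by
  obtain rfl : k = l := funext fun i => funext fun j => h i j
  rfl

/-- Products of operators correspond to products of matrices. -/
theorem ofKernel_mul {k l m : ι → ι → ℂ} (hk : IsBanded k) (hl : IsBanded l) (hm : IsBanded m)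
    (h : ∀ i j, m i j = ∑' q, k i q * l q j) : ofKernel k hk * ofKernel l hl = ofKernel m hm := by
  classical
  refine ContinuousLinearMap.ext fun v => lp.ext (funext fun i => ?_)
  change ∑' q, k i q * (∑' j, l q j * v j) = ∑' j, m i j * v j
  rw [hk.tsum_eq (fun q => ∑' j, l q j * v j)]
  set R := (hk.finite_row i).toFinset
  set B := R.biUnion fun q => (hl.finite_row q).toFinset with hB
  have hl0 : ∀ q ∈ R, ∀ j ∉ B, l q j = 0 := fun q hq j hj => by
    by_contra h0
    exact hj (Finset.mem_biUnion.2 ⟨q, hq, by simpa using h0⟩)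
  have hm' : ∀ j, m i j = ∑ q ∈ R, k i q * l q j := fun j => by
    rw [h, hk.tsum_eq (fun q => l q j)]
  have e1 : ∑' j, m i j * v j = ∑ j ∈ B, m i j * v j := by
    refine tsum_eq_sum fun j hj => ?_
    rw [hm', Finset.sum_eq_zero, zero_mul]
    intro q hq
    rw [hl0 q hq j hj, mul_zero]
  have e2 : ∀ q ∈ R, ∑' j, l q j * v j = ∑ j ∈ B, l q j * v j := fun q hq => by
    refine tsum_eq_sum fun j hj => ?_
    rw [hl0 q hq j hj, zero_mul]
  rw [e1, Finset.sum_congr rfl fun q hq => by rw [e2 q hq]]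
  simp_rw [Finset.mul_sum, hm', Finset.sum_mul]
  rw [Finset.sum_comm]
  exact Finset.sum_congr rfl fun _ _ => Finset.sum_congr rfl fun _ _ => by ring

/-- The adjoint has the conjugate transpose as its matrix. -/
theorem star_ofKernel {k l : ι → ι → ℂ} (hk : IsBanded k) (hl : IsBanded l)
    (h : ∀ i j, l i j = star (k j i)) : star (ofKernel k hk) = ofKernel l hl := by
  classical
  rw [ContinuousLinearMap.star_eq_adjoint]
  refine ContinuousLinearMap.ext fun v => lp.ext (funext fun i => ?_)
  have h1 := lp.inner_single_left (𝕜 := ℂ) i (1 : ℂ)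
    (ContinuousLinearMap.adjoint (ofKernel k hk) v)
  rw [ContinuousLinearMap.adjoint_inner_right, lp.inner_eq_tsum] at h1
  have h2 : ContinuousLinearMap.adjoint (ofKernel k hk) v i =
      inner ℂ (1 : ℂ) (ContinuousLinearMap.adjoint (ofKernel k hk) v i) := by simp
  rw [h2, ← h1, ofKernel_apply]
  refine tsum_congr fun j => ?_
  have h3 : ofKernel k hk (lp.single 2 i (1 : ℂ)) j = k j i := by
    rw [ofKernel_apply, tsum_eq_single i]
    · rw [lp.single_apply_self, mul_one]
    · intro q hq
      rw [lp.single_apply_ne _ _ _ hq, mul_zero]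
  rw [h3, h]
  simp [mul_comm]

open Classical in
/-- The diagonal matrix with entries `a i`. -/
def diagKernel (a : ι → ℂ) (i j : ι) : ℂ := if i = j then a i else 0

theorem isBanded_diagKernel {a : ι → ℂ} (ha : ∃ C : ℝ, ∀ i, ‖a i‖ ≤ C) :
    IsBanded (diagKernel a) := by
  obtain ⟨C, ha⟩ := ha
  refine ⟨1, |C|, fun i => ?_, fun j => ?_, fun i j => ?_⟩
  · refine (Set.encard_le_encard (t := {i}) fun j hj => ?_).trans (by simp)
    by_contra hne
    exact hj (if_neg fun h => hne h.symm)
  · refine (Set.encard_le_encard (t := {j}) fun i hi => ?_).trans (by simp)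
    by_contra hne
    exact hi (if_neg hne)
  · unfold diagKernel
    split_ifs
    · exact (ha i).trans (le_abs_self C)
    · simp

/-- The operator on `ℓ²(ι)` of pointwise multiplication by a bounded function `a`. -/
def mulOp (a : ι → ℂ) (ha : ∃ C : ℝ, ∀ i, ‖a i‖ ≤ C) : EllTwo ι →L[ℂ] EllTwo ι :=
  ofKernel (diagKernel a) (isBanded_diagKernel ha)

theorem mulOp_apply (a : ι → ℂ) (ha : ∃ C : ℝ, ∀ i, ‖a i‖ ≤ C) (v : EllTwo ι) (i : ι) :
    mulOp a ha v i = a i * v i := by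
  rw [mulOp, ofKernel_apply, tsum_eq_single i]
  · simp [diagKernel]
  · intro j hj
    simp [diagKernel, hj.symm]

theorem mulOp_congr {a b : ι → ℂ} (ha : ∃ C : ℝ, ∀ i, ‖a i‖ ≤ C) (hb : ∃ C : ℝ, ∀ i, ‖b i‖ ≤ C)
    (h : ∀ i, a i = b i) : mulOp a ha = mulOp b hb := by
  obtain rfl : a = b := funext h
  rfl

theorem star_mulOp {a b : ι → ℂ} (ha : ∃ C : ℝ, ∀ i, ‖a i‖ ≤ C) (hb : ∃ C : ℝ, ∀ i, ‖b i‖ ≤ C)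
    (h : ∀ i, b i = star (a i)) : star (mulOp a ha) = mulOp b hb := by
  refine star_ofKernel _ _ fun i j => ?_
  unfold diagKernel
  by_cases hij : i = j
  · simp [hij, h]
  · simp [hij, Ne.symm hij]

theorem mulOp_mul {a b c : ι → ℂ} (ha : ∃ C : ℝ, ∀ i, ‖a i‖ ≤ C) (hb : ∃ C : ℝ, ∀ i, ‖b i‖ ≤ C)
    (hc : ∃ C : ℝ, ∀ i, ‖c i‖ ≤ C) (h : ∀ i, c i = a i * b i) :
    mulOp a ha * mulOp b hb = mulOp c hc := by
  refine ContinuousLinearMap.ext fun v => lp.ext (funext fun i => ?_)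
  change mulOp a ha (mulOp b hb v) i = _
  rw [mulOp_apply, mulOp_apply, mulOp_apply, h, mul_assoc]

/-- Conjugating an operator with matrix `k` by multiplication operators. -/
theorem mulOp_mul_ofKernel_mul_mulOp {a b : ι → ℂ} {k l : ι → ι → ℂ}
    (ha : ∃ C : ℝ, ∀ i, ‖a i‖ ≤ C) (hb : ∃ C : ℝ, ∀ i, ‖b i‖ ≤ C) (hk : IsBanded k)
    (hl : IsBanded l) (h : ∀ i j, l i j = a i * k i j * b j) :
    mulOp a ha * ofKernel k hk * mulOp b hb = ofKernel l hl := by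
  refine ContinuousLinearMap.ext fun v => lp.ext (funext fun i => ?_)
  change mulOp a ha (ofKernel k hk (mulOp b hb v)) i = _
  rw [mulOp_apply, ofKernel_apply, ofKernel_apply, ← tsum_mul_left]
  refine tsum_congr fun j => ?_
  rw [mulOp_apply, h]
  ring

theorem mulOp_add {a b c : ι → ℂ} (ha : ∃ C : ℝ, ∀ i, ‖a i‖ ≤ C) (hb : ∃ C : ℝ, ∀ i, ‖b i‖ ≤ C)
    (hc : ∃ C : ℝ, ∀ i, ‖c i‖ ≤ C) (h : ∀ i, c i = a i + b i) :
    mulOp c hc = mulOp a ha + mulOp b hb := by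
  refine ContinuousLinearMap.ext fun v => lp.ext (funext fun i => ?_)
  change mulOp c hc v i = mulOp a ha v i + mulOp b hb v i
  rw [mulOp_apply, mulOp_apply, mulOp_apply, h, add_mul]

theorem mulOp_smul {a c : ι → ℂ} (z : ℂ) (ha : ∃ C : ℝ, ∀ i, ‖a i‖ ≤ C)
    (hc : ∃ C : ℝ, ∀ i, ‖c i‖ ≤ C) (h : ∀ i, c i = z * a i) : mulOp c hc = z • mulOp a ha := by
  refine ContinuousLinearMap.ext fun v => lp.ext (funext fun i => ?_)
  change mulOp c hc v i = z * mulOp a ha v i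
  rw [mulOp_apply, mulOp_apply, h, mul_assoc]

theorem norm_mulOp_sub_le {a b : ι → ℂ} (ha : ∃ C : ℝ, ∀ i, ‖a i‖ ≤ C)
    (hb : ∃ C : ℝ, ∀ i, ‖b i‖ ≤ C) {ε : ℝ} (hε : 0 ≤ ε) (h : ∀ i, ‖a i - b i‖ ≤ ε) :
    ‖mulOp a ha - mulOp b hb‖ ≤ ε := by
  refine ContinuousLinearMap.opNorm_le_bound _ hε fun v => ?_
  refine lp.norm_le_of_forall_sum_le (p := 2) (by norm_num) (by positivity) fun s => ?_
  have h1 := lp.sum_rpow_le_norm_rpow (p := 2) (by norm_num) v s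
  simp only [ENNReal.toReal_ofNat, Real.rpow_ofNat] at h1 ⊢
  calc ∑ i ∈ s, ‖(mulOp a ha - mulOp b hb) v i‖ ^ 2 ≤ ∑ i ∈ s, ε ^ 2 * ‖v i‖ ^ 2 := by
        refine Finset.sum_le_sum fun i _ => ?_
        have h2 : (mulOp a ha - mulOp b hb) v i = (a i - b i) * v i := by
          change mulOp a ha v i - mulOp b hb v i = _
          rw [mulOp_apply, mulOp_apply, sub_mul]
        rw [h2, norm_mul, mul_pow]
        gcongr
        exact h i
    _ ≤ ε ^ 2 * ‖v‖ ^ 2 := by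
        rw [← Finset.mul_sum]
        gcongr
    _ = _ := by ring

theorem ofKernel_add {k l m : ι → ι → ℂ} (hk : IsBanded k) (hl : IsBanded l) (hm : IsBanded m)
    (h : ∀ i j, m i j = k i j + l i j) : ofKernel m hm = ofKernel k hk + ofKernel l hl := by
  refine ContinuousLinearMap.ext fun v => lp.ext (funext fun i => ?_)
  change ∑' j, m i j * v j = ∑' j, k i j * v j + ∑' j, l i j * v j
  rw [← Summable.tsum_add]
  · exact tsum_congr fun j => by rw [h, add_mul]
  · refine summable_of_hasFiniteSupport ((hk.finite_row i).subset fun j hj hj' => hj ?_)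
    simp [hj']
  · refine summable_of_hasFiniteSupport ((hl.finite_row i).subset fun j hj hj' => hj ?_)
    simp [hj']

theorem ofKernel_smul {k m : ι → ι → ℂ} (c : ℂ) (hk : IsBanded k) (hm : IsBanded m)
    (h : ∀ i j, m i j = c * k i j) : ofKernel m hm = c • ofKernel k hk := by
  refine ContinuousLinearMap.ext fun v => lp.ext (funext fun i => ?_)
  change ∑' j, m i j * v j = c * ∑' j, k i j * v j
  rw [← tsum_mul_left]
  exact tsum_congr fun j => by rw [h, mul_assoc]

end KernelOperator

/-- A Deaconu-Renault system on a locally compact Hausdorff space `X`: a local homeomorphism `σ`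
from an open subset `dom` of `X` onto an open subset of `X` (the range is automatically open, as
local homeomorphisms are open maps). The map is recorded as a total function whose values outside
`dom` are irrelevant and never used. -/
structure DeaconuRenaultSystem (X : Type*) [TopologicalSpace X] [LocallyCompactSpace X]
    [T2Space X] where
  dom : Set X
  isOpen_dom : IsOpen dom
  σ : X → X
  isLocalHomeomorphOn : IsLocalHomeomorphOn σ dom

namespace DeaconuRenaultSystem

variable {X : Type*} [TopologicalSpace X] [LocallyCompactSpace X] [T2Space X]
  (S : DeaconuRenaultSystem X)

/-- The domain of the `k`-th iterate: `dom σ⁰ = X` and `dom σᵏ⁺¹ = σ⁻¹(dom σᵏ)`. On it, the `k`-th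
iterate is `S.σ^[k]`. -/
def domIter : ℕ → Set X
  | 0 => Set.univ
  | k + 1 => {x | x ∈ S.dom ∧ S.σ x ∈ domIter k}

theorem isLocalHomeomorphOn_iterate (k : ℕ) :
    IsOpen (S.domIter k) ∧ IsLocalHomeomorphOn S.σ^[k] (S.domIter k) := by
  induction k with
  | zero =>
    refine ⟨isOpen_univ, fun x _ => ⟨OpenPartialHomeomorph.refl X, Set.mem_univ x, rfl⟩⟩
  | succ k ih =>
    refine ⟨S.isLocalHomeomorphOn.continuousOn.isOpen_inter_preimage S.isOpen_dom ih.1, ?_⟩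
    exact ih.2.comp (S.isLocalHomeomorphOn.mono fun x hx => hx.1) fun x hx => hx.2

theorem isOpen_domIter (k : ℕ) : IsOpen (S.domIter k) := (S.isLocalHomeomorphOn_iterate k).1

theorem mem_domIter_add (m k : ℕ) (x : X) :
    x ∈ S.domIter (m + k) ↔ x ∈ S.domIter m ∧ S.σ^[m] x ∈ S.domIter k := by
  induction m generalizing x with
  | zero => simp [domIter]
  | succ m ih =>
    rw [Nat.succ_add]
    change (x ∈ S.dom ∧ S.σ x ∈ S.domIter (m + k)) ↔ _
    rw [ih]
    exact and_assoc.symm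

/-- `x ∈ dom σᵐ`, `y ∈ dom σⁿ` and `σᵐ(x) = σⁿ(y)`. -/
def TailEq (m n : ℕ) (x y : X) : Prop :=
  x ∈ S.domIter m ∧ y ∈ S.domIter n ∧ S.σ^[m] x = S.σ^[n] y

variable {S}

theorem TailEq.symm {m n : ℕ} {x y : X} (h : S.TailEq m n x y) : S.TailEq n m y x :=
  ⟨h.2.1, h.1, h.2.2.symm⟩

theorem TailEq.add {m n : ℕ} {x y : X} (h : S.TailEq m n x y) {k : ℕ}
    (hk : x ∈ S.domIter (m + k)) : S.TailEq (m + k) (n + k) x y := by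
  refine ⟨hk, (S.mem_domIter_add _ _ _).2 ⟨h.2.1, ?_⟩, ?_⟩
  · rw [← h.2.2]
    exact ((S.mem_domIter_add _ _ _).1 hk).2
  · rw [Nat.add_comm m k, Nat.add_comm n k, Function.iterate_add_apply, Function.iterate_add_apply,
      h.2.2]

theorem TailEq.trans {a b c d : ℕ} {x y z : X} (h : S.TailEq a b x y) (h' : S.TailEq c d y z) :
    ∃ a' b' d' : ℕ, (a' : ℤ) - b' = a - b ∧ (b' : ℤ) - d' = c - d ∧ S.TailEq a' b' x y ∧
      S.TailEq b' d' y z := by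
  rcases le_total b c with hbc | hbc
  · obtain ⟨k, rfl⟩ := Nat.exists_eq_add_of_le hbc
    exact ⟨a + k, b + k, d, by push_cast; ring, rfl, (h.symm.add h'.1).symm, h'⟩
  · obtain ⟨k, rfl⟩ := Nat.exists_eq_add_of_le hbc
    exact ⟨a, c + k, d + k, rfl, by push_cast; ring, h, h'.add h.2.1⟩

variable (S)

/-- The Deaconu-Renault groupoid of `S`: triples `(x, p, y)` for which there are `m, n ∈ ℕ` with
`p = m - n`, `x ∈ dom σᵐ`, `y ∈ dom σⁿ` and `σᵐ(x) = σⁿ(y)`. Here `x` is the range and `y` is the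
source of `(x, p, y)`. -/
@[ext]
structure Groupoid where
  rng : X
  deg : ℤ
  src : X
  exists_tailEq : ∃ m n : ℕ, deg = m - n ∧ S.TailEq m n rng src

namespace Groupoid

variable {S}

/-- The product `(x, p, y)(y, q, z) = (x, p + q, z)`. -/
def comp (g h : S.Groupoid) (hgh : g.src = h.rng) : S.Groupoid where
  rng := g.rng
  deg := g.deg + h.deg
  src := h.src
  exists_tailEq := by
    obtain ⟨a, b, e, t⟩ := g.exists_tailEq
    obtain ⟨c, d, e', t'⟩ := h.exists_tailEq
    rw [← hgh] at t'
    obtain ⟨a', b', d', e1, e2, t1, t2⟩ := t.trans t'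
    exact ⟨a', d', by rw [e, e', ← e1, ← e2]; ring, t1.1, t2.2.1, t1.2.2.trans t2.2.2⟩

/-- The inverse `(x, p, y)⁻¹ = (y, -p, x)`. -/
def inv (g : S.Groupoid) : S.Groupoid where
  rng := g.src
  deg := -g.deg
  src := g.rng
  exists_tailEq := by
    obtain ⟨a, b, e, t⟩ := g.exists_tailEq
    exact ⟨b, a, by rw [e]; ring, t.symm⟩

theorem rng_inv (g : S.Groupoid) : g.inv.rng = g.src := rfl

/-- The product `g h⁻¹` of two elements with the same source. -/
def mulInv (g h : S.Groupoid) (hs : g.src = h.src) : S.Groupoid :=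
  g.comp h.inv (hs.trans (rng_inv h).symm)

/-- The unit `(x, 0, x)`. -/
def unit (x : X) : S.Groupoid where
  rng := x
  deg := 0
  src := x
  exists_tailEq := ⟨0, 0, by simp, trivial, trivial, rfl⟩

variable (S) in
/-- The set `Z(U, m, n, V)` of all `(x, m - n, y)` with `x ∈ U`, `y ∈ V`, `σᵐ(x) = σⁿ(y)`. -/
def Z (U : Set X) (m n : ℕ) (V : Set X) : Set S.Groupoid :=
  {g | g.rng ∈ U ∧ g.deg = m - n ∧ g.src ∈ V ∧ S.TailEq m n g.rng g.src}

/-- The topology generated by the sets `Z(U, m, n, V)` with `U` and `V` open. -/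
instance instTopologicalSpace : TopologicalSpace S.Groupoid :=
  TopologicalSpace.generateFrom
    {W | ∃ (U V : Set X) (m n : ℕ), IsOpen U ∧ IsOpen V ∧ W = Z S U m n V}

theorem isOpen_Z {U V : Set X} (hU : IsOpen U) (hV : IsOpen V) (m n : ℕ) : IsOpen (Z S U m n V) :=
  TopologicalSpace.isOpen_generateFrom_of_mem ⟨U, V, m, n, hU, hV, rfl⟩

theorem Z_mem_nhds {g : S.Groupoid} {m n : ℕ} (hd : g.deg = m - n)
    (ht : S.TailEq m n g.rng g.src) : Z S Set.univ m n Set.univ ∈ 𝓝 g :=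
  (isOpen_Z isOpen_univ isOpen_univ m n).mem_nhds ⟨trivial, hd, trivial, ht⟩

theorem continuous_rng : Continuous (rng : S.Groupoid → X) := by
  refine continuous_def.2 fun U hU => ?_
  have : rng ⁻¹' U = ⋃ (m : ℕ) (n : ℕ), Z S U m n Set.univ := by
    ext g
    simp only [Set.mem_preimage, Set.mem_iUnion]
    constructor
    · intro h
      obtain ⟨m, n, e, t⟩ := g.exists_tailEq
      exact ⟨m, n, h, e, trivial, t⟩
    · rintro ⟨m, n, h, -⟩
      exact h
  rw [this]
  exact isOpen_iUnion fun m => isOpen_iUnion fun n => isOpen_Z hU isOpen_univ m n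

theorem continuous_src : Continuous (src : S.Groupoid → X) := by
  refine continuous_def.2 fun U hU => ?_
  have : src ⁻¹' U = ⋃ (m : ℕ) (n : ℕ), Z S Set.univ m n U := by
    ext g
    simp only [Set.mem_preimage, Set.mem_iUnion]
    constructor
    · intro h
      obtain ⟨m, n, e, t⟩ := g.exists_tailEq
      exact ⟨m, n, trivial, e, h, t⟩
    · rintro ⟨m, n, -, -, h, -⟩
      exact h
  rw [this]
  exact isOpen_iUnion fun m => isOpen_iUnion fun n => isOpen_Z isOpen_univ hU m n

/-- Near a point of `Z(X, m, n, X)`, the topology is that of pairs (range, source). -/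
theorem tendsto_nhds_of {α : Type*} {l : Filter α} {τ : α → S.Groupoid} {g : S.Groupoid} {m n : ℕ}
    (hd : g.deg = m - n) (ht : S.TailEq m n g.rng g.src)
    (hr : Filter.Tendsto (fun a => (τ a).rng) l (𝓝 g.rng))
    (hs : Filter.Tendsto (fun a => (τ a).src) l (𝓝 g.src))
    (hZ : ∀ᶠ a in l, (τ a).deg = m - n ∧ S.TailEq m n (τ a).rng (τ a).src) :
    Filter.Tendsto τ l (𝓝 g) := by
  rw [TopologicalSpace.tendsto_nhds_generateFrom_iff]
  rintro W ⟨U, V, m', n', hU, hV, rfl⟩ ⟨hgU, hgd, hgV, hgt⟩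
  have h0 : (m : ℤ) - n = m' - n' := hd ▸ hgd
  have hrm : ∀ᶠ a in l, (τ a).rng ∈ S.domIter m' := hr ((S.isOpen_domIter m').mem_nhds hgt.1)
  have hsn : ∀ᶠ a in l, (τ a).src ∈ S.domIter n' := hs ((S.isOpen_domIter n').mem_nhds hgt.2.1)
  suffices h : ∀ᶠ a in l, S.TailEq m' n' (τ a).rng (τ a).src by
    filter_upwards [hr (hU.mem_nhds hgU), hs (hV.mem_nhds hgV), hZ, h] with a h1 h2 h3 h4
    exact ⟨h1, h3.1.trans h0, h2, h4⟩
  rcases le_total m m' with h | h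
  · obtain ⟨k, rfl⟩ := Nat.exists_eq_add_of_le h
    obtain rfl : n' = n + k := by push_cast at h0; omega
    filter_upwards [hrm, hZ] with a h1 h2
    exact h2.2.add h1
  · obtain ⟨k, rfl⟩ := Nat.exists_eq_add_of_le h
    obtain rfl : n = n' + k := by push_cast at h0; omega
    have hk : S.σ^[m'] g.rng ∈ S.domIter k := ((S.mem_domIter_add _ _ _).1 ht.1).2
    obtain ⟨e, he, hek⟩ := (S.isLocalHomeomorphOn_iterate k).2 _ hk
    have h1 : ∀ᶠ a in l, S.σ^[m'] (τ a).rng ∈ e.source :=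
      (((S.isLocalHomeomorphOn_iterate m').2.continuousAt hgt.1).tendsto.comp hr)
        (e.open_source.mem_nhds he)
    have h2 : ∀ᶠ a in l, S.σ^[n'] (τ a).src ∈ e.source :=
      (((S.isLocalHomeomorphOn_iterate n').2.continuousAt hgt.2.1).tendsto.comp hs)
        (e.open_source.mem_nhds (hgt.2.2 ▸ he))
    filter_upwards [hrm, hsn, h1, h2, hZ] with a h3 h4 h5 h6 h7
    refine ⟨h3, h4, e.injOn h5 h6 ?_⟩
    rw [← hek, ← Function.iterate_add_apply, ← Function.iterate_add_apply, Nat.add_comm k m',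
      Nat.add_comm k n']
    exact h7.2.2.2

protected theorem continuous_inv : Continuous (inv : S.Groupoid → S.Groupoid) := by
  refine continuous_iff_continuousAt.2 fun g => ?_
  obtain ⟨m, n, hd, ht⟩ := g.exists_tailEq
  refine tendsto_nhds_of (m := n) (n := m) (by simp [inv, hd]) ht.symm continuous_src.continuousAt
    continuous_rng.continuousAt ?_
  filter_upwards [Z_mem_nhds hd ht] with h hh
  exact ⟨by simp [inv, hh.2.1], hh.2.2.2.symm⟩

theorem inv_inv (g : S.Groupoid) : g.inv.inv = g := by
  ext <;> simp [inv]

theorem tendsto_comp {α : Type*} {l : Filter α} {τ ρ : α → S.Groupoid} {g h : S.Groupoid}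
    (hgh : g.src = h.rng) (hτρ : ∀ a, (τ a).src = (ρ a).rng) (hτ : Filter.Tendsto τ l (𝓝 g))
    (hρ : Filter.Tendsto ρ l (𝓝 h)) :
    Filter.Tendsto (fun a => (τ a).comp (ρ a) (hτρ a)) l (𝓝 (g.comp h hgh)) := by
  obtain ⟨a, b, e, t⟩ := g.exists_tailEq
  obtain ⟨c, d, e', t'⟩ := h.exists_tailEq
  rw [← hgh] at t'
  obtain ⟨a', b', d', e1, e2, t1, t2⟩ := t.trans t'
  refine tendsto_nhds_of (m := a') (n := d') ?_ ⟨t1.1, t2.2.1, t1.2.2.trans t2.2.2⟩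
    (((continuous_rng.tendsto g).comp hτ :)) (((continuous_src.tendsto h).comp hρ :)) ?_
  · simp only [comp, e, e', ← e1, ← e2]; ring
  · filter_upwards [hτ (Z_mem_nhds (e.trans e1.symm) t1),
      hρ (Z_mem_nhds (e'.trans e2.symm) (hgh ▸ t2))] with i hi hi'
    refine ⟨?_, hi.2.2.2.1, hi'.2.2.2.2.1, hi.2.2.2.2.2.trans ?_⟩
    · have h1 := hi.2.1
      have h2 := hi'.2.1
      simp only [comp, h1, h2]; ring
    · rw [hτρ]
      exact hi'.2.2.2.2.2

instance instT2Space : T2Space S.Groupoid := by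
  refine ⟨fun g h hgh => ?_⟩
  by_cases h1 : g.rng = h.rng
  · by_cases h2 : g.src = h.src
    · obtain ⟨m, n, hd, ht⟩ := g.exists_tailEq
      obtain ⟨m', n', hd', ht'⟩ := h.exists_tailEq
      refine ⟨_, _, isOpen_Z isOpen_univ isOpen_univ m n, isOpen_Z isOpen_univ isOpen_univ m' n',
        ⟨trivial, hd, trivial, ht⟩, ⟨trivial, hd', trivial, ht'⟩, ?_⟩
      refine Set.disjoint_left.2 fun q hq hq' => hgh ?_
      ext
      · exact h1
      · rw [hd, hd', ← hq.2.1, ← hq'.2.1]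
      · exact h2
    · exact separated_by_continuous continuous_src h2
  · exact separated_by_continuous continuous_rng h1

/-- A local section of the source map through `g`; the source map is injective near `g`. -/
theorem exists_local_section (g : S.Groupoid) :
    ∃ W ∈ 𝓝 g, Set.InjOn src W ∧ ∃ τ : X → S.Groupoid, τ g.src = g ∧
      Filter.Tendsto τ (𝓝 g.src) (𝓝 g) ∧ ∀ y, (τ y).src = y := by
  classical
  obtain ⟨m, n, hd, ht⟩ := g.exists_tailEq
  obtain ⟨e, he, hem⟩ := (S.isLocalHomeomorphOn_iterate m).2 _ ht.1
  refine ⟨Z S e.source m n Set.univ,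
    (isOpen_Z e.open_source isOpen_univ m n).mem_nhds ⟨he, hd, trivial, ht⟩, ?_, ?_⟩
  · intro a ha b hb hab
    ext
    · refine e.injOn ha.1 hb.1 ?_
      rw [← hem, ha.2.2.2.2.2, hb.2.2.2.2.2, hab]
    · rw [ha.2.1, hb.2.1]
    · exact hab
  · set t : X → X := fun y => e.symm (S.σ^[n] y) with ht'
    have hcn := (S.isLocalHomeomorphOn_iterate n).2.continuousAt ht.2.1
    have hy : S.σ^[n] g.src = e g.rng := by rw [← hem, ht.2.2]
    have ht0 : t g.src = g.rng := by rw [ht']; simp only [hy]; exact e.left_inv he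
    have htc : Filter.Tendsto t (𝓝 g.src) (𝓝 g.rng) := by
      have h1 : ContinuousAt e.symm (S.σ^[n] g.src) := by
        rw [hy]
        exact e.symm.continuousAt (e.map_source he)
      have := h1.comp hcn
      rw [← ht0]
      exact this
    have hT : ∀ᶠ y in 𝓝 g.src, S.TailEq m n (t y) y := by
      filter_upwards [htc ((S.isOpen_domIter m).mem_nhds ht.1), (S.isOpen_domIter n).mem_nhds ht.2.1,
        hcn (e.open_target.mem_nhds (hy ▸ e.map_source he))] with y h1 h2 h3
      exact ⟨h1, h2, by rw [hem]; exact e.right_inv h3⟩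
    refine ⟨fun y => if h : S.TailEq m n (t y) y then ⟨t y, m - n, y, m, n, rfl, h⟩ else unit y,
      ?_, ?_, ?_⟩
    · refine (dif_pos (show S.TailEq m n (t g.src) g.src by rw [ht0]; exact ht)).trans ?_
      ext
      · exact ht0
      · exact hd.symm
      · rfl
    · refine tendsto_nhds_of hd ht ?_ ?_ ?_
      · refine htc.congr' ?_
        filter_upwards [hT] with y h
        rw [dif_pos h]
      · refine Filter.tendsto_id.congr' ?_
        filter_upwards [hT] with y h
        rw [dif_pos h]
        rfl
      · filter_upwards [hT] with y h
        rw [dif_pos h]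
        exact ⟨rfl, h⟩
    · intro y
      dsimp only
      split_ifs <;> rfl

theorem exists_encard_src_fibre_le {K : Set S.Groupoid} (hK : IsCompact K) :
    ∃ N : ℕ, ∀ y, {g ∈ K | g.src = y}.encard ≤ N := by
  choose W hW hinj _ using exists_local_section (S := S)
  obtain ⟨t, -, ht⟩ := hK.elim_nhds_subcover W fun g _ => hW g
  refine ⟨t.card, fun y => ?_⟩
  have h1 : {g ∈ K | g.src = y} ⊆ ⋃ w ∈ t, {g ∈ W w | g.src = y} := by
    rintro g ⟨hg, hy⟩
    obtain ⟨w, hw, hgw⟩ := Set.mem_iUnion₂.1 (ht hg)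
    exact Set.mem_iUnion₂.2 ⟨w, hw, hgw, hy⟩
  refine (Set.encard_le_encard h1).trans ((Finset.set_encard_biUnion_le _ _).trans ?_)
  refine (Finset.sum_le_card_nsmul t _ 1 fun w _ => ?_).trans (by simp)
  refine Set.encard_le_one_iff.2 fun a b ha hb => hinj w ha.1 hb.1 (ha.2.trans hb.2.symm)

theorem exists_encard_rng_fibre_le {K : Set S.Groupoid} (hK : IsCompact K) :
    ∃ N : ℕ, ∀ x, {g ∈ K | g.rng = x}.encard ≤ N := by
  obtain ⟨N, hN⟩ := exists_encard_src_fibre_le (hK.image Groupoid.continuous_inv)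
  refine ⟨N, fun x => le_trans ?_ (hN x)⟩
  refine Set.encard_le_encard_of_injOn (f := inv) (fun g hg => ⟨⟨g, hg.1, rfl⟩, hg.2⟩) ?_
  intro a _ b _ hab
  rw [← inv_inv a, hab, inv_inv]

end Groupoid

open Groupoid KernelOperator

variable {S}

/-! ### The convolution algebra and the regular representation -/

open Classical in
/-- The matrix `(g, h) ↦ ξ(g h⁻¹)` if `g` and `h` have the same source, and `0` otherwise. -/
def regKernel (ξ : S.Groupoid → ℂ) (g h : S.Groupoid) : ℂ :=
  if hs : g.src = h.src then ξ (g.mulInv h hs) else 0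

theorem regKernel_of_eq (ξ : S.Groupoid → ℂ) {g h : S.Groupoid} (hs : g.src = h.src) :
    regKernel ξ g h = ξ (g.mulInv h hs) := dif_pos hs

theorem regKernel_of_ne (ξ : S.Groupoid → ℂ) {g h : S.Groupoid} (hs : g.src ≠ h.src) :
    regKernel ξ g h = 0 := dif_neg hs

theorem src_eq_of_regKernel_ne_zero {ξ : S.Groupoid → ℂ} {g h : S.Groupoid}
    (hk : regKernel ξ g h ≠ 0) : g.src = h.src := by
  by_contra hs
  exact hk (regKernel_of_ne ξ hs)

theorem isBanded_regKernel (ξ : C_c(S.Groupoid, ℂ)) : IsBanded (regKernel ξ) := by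
  classical
  obtain ⟨C, hC⟩ := ξ.hasCompactSupport.exists_bound_of_continuous ξ.continuous
  obtain ⟨N, hN⟩ := exists_encard_rng_fibre_le ξ.hasCompactSupport
  obtain ⟨M, hM⟩ := exists_encard_src_fibre_le ξ.hasCompactSupport
  have hmem : ∀ {q : S.Groupoid}, ξ q ≠ 0 → q ∈ tsupport ξ := fun h => subset_tsupport _ h
  refine ⟨max N M, max C 0, fun g => ?_, fun h => ?_, fun g h => ?_⟩
  · refine le_trans ?_ ((hN g.rng).trans (by exact_mod_cast le_max_left N M))
    refine Set.encard_le_encard_of_injOn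
      (f := fun h => if hs : g.src = h.src then g.mulInv h hs else g) ?_ ?_
    · intro h hh
      have hs := src_eq_of_regKernel_ne_zero hh
      have hh' : ξ (g.mulInv h hs) ≠ 0 := by rwa [← regKernel_of_eq ξ hs]
      dsimp only
      rw [dif_pos hs]
      exact ⟨hmem hh', rfl⟩
    · intro h hh q hq hhq
      have hs := src_eq_of_regKernel_ne_zero hh
      have hs' := src_eq_of_regKernel_ne_zero hq
      dsimp only at hhq
      rw [dif_pos hs, dif_pos hs'] at hhq
      ext
      · exact congrArg Groupoid.src hhq
      · have := congrArg Groupoid.deg hhq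
        simpa [mulInv, comp, inv] using this
      · exact hs.symm.trans hs'
  · refine le_trans ?_ ((hM h.rng).trans (by exact_mod_cast le_max_right N M))
    refine Set.encard_le_encard_of_injOn
      (f := fun g => if hs : g.src = h.src then g.mulInv h hs else g) ?_ ?_
    · intro g hg
      have hs := src_eq_of_regKernel_ne_zero hg
      have hg' : ξ (g.mulInv h hs) ≠ 0 := by rwa [← regKernel_of_eq ξ hs]
      dsimp only
      rw [dif_pos hs]
      exact ⟨hmem hg', rfl⟩
    · intro g hg q hq hgq
      have hs := src_eq_of_regKernel_ne_zero hg
      have hs' := src_eq_of_regKernel_ne_zero hq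
      dsimp only at hgq
      rw [dif_pos hs, dif_pos hs'] at hgq
      ext
      · have := congrArg Groupoid.rng hgq
        simpa [mulInv, comp, inv] using this
      · have := congrArg Groupoid.deg hgq
        simpa [mulInv, comp, inv] using this
      · exact hs.trans hs'.symm
  · by_cases hs : g.src = h.src
    · rw [regKernel_of_eq _ hs]
      exact (hC _).trans (le_max_left _ _)
    · rw [regKernel_of_ne _ hs]
      simp

/-- The convolution product `(ξ * η)(g) = ∑ ξ(g h⁻¹) η(h)`, the sum running over all `h` with the
same source as `g`; it has only finitely many nonzero terms. -/
def convFun (ξ η : C_c(S.Groupoid, ℂ)) (g : S.Groupoid) : ℂ :=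
  ∑' h, regKernel ξ g h * η h

theorem continuous_convFun (ξ η : C_c(S.Groupoid, ℂ)) : Continuous (convFun ξ η) := by
  classical
  refine continuous_iff_continuousAt.2 fun g₀ => ?_
  set K := tsupport η with hKdef
  have hK : IsCompact K := η.hasCompactSupport
  set y₀ := g₀.src
  obtain ⟨N, hN⟩ := exists_encard_src_fibre_le hK
  have hF : {h ∈ K | h.src = y₀}.Finite := Set.finite_of_encard_le_coe (hN y₀)
  set F := hF.toFinset with hFdef
  have hFs : ∀ h ∈ F, h.src = y₀ := fun h hh => (hF.mem_toFinset.1 hh).2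
  choose W hW hinj τ hτ hτt hτs using exists_local_section (S := S)
  obtain ⟨D, hD, hDd⟩ := F.finite_toSet.t2_separation
  have hτt' : ∀ h ∈ F, Filter.Tendsto (τ h) (𝓝 y₀) (𝓝 h) := fun h hh => by
    have := hτt h
    rwa [hFs h hh] at this
  have ev1 : ∀ᶠ y in 𝓝 y₀, ∀ h ∈ F, τ h y ∈ D h ∩ interior (W h) := by
    refine (Filter.eventually_all_finset F).2 fun h hh => hτt' h hh ?_
    exact Filter.inter_mem ((hD h).2.mem_nhds (hD h).1)
      (isOpen_interior.mem_nhds (mem_interior_iff_mem_nhds.2 (hW h)))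
  have ev2 : ∀ᶠ y in 𝓝 y₀, ∀ q ∈ K, q.src = y → ∃ h ∈ F, q ∈ interior (W h) := by
    set L := K \ ⋃ h ∈ F, interior (W h) with hL
    have hLc : IsCompact L := hK.diff (isOpen_biUnion fun _ _ => isOpen_interior)
    have hcl : IsClosed (Groupoid.src '' L) := (hLc.image continuous_src).isClosed
    have hy : y₀ ∉ Groupoid.src '' L := by
      rintro ⟨q, ⟨hqK, hq⟩, hqy⟩
      refine hq (Set.mem_iUnion₂.2 ⟨q, hF.mem_toFinset.2 ⟨hqK, hqy⟩, ?_⟩)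
      exact mem_interior_iff_mem_nhds.2 (hW q)
    filter_upwards [hcl.isOpen_compl.mem_nhds hy] with y hy' q hq hqy
    by_contra hcon
    refine hy' ⟨q, ⟨hq, fun hq' => hcon ?_⟩, hqy⟩
    obtain ⟨h, hh, hqh⟩ := Set.mem_iUnion₂.1 hq'
    exact ⟨h, hh, hqh⟩
  have hsrc : Filter.Tendsto Groupoid.src (𝓝 g₀) (𝓝 y₀) := continuous_src.tendsto g₀
  have key : ∀ᶠ g in 𝓝 g₀, convFun ξ η g =
      ∑ h ∈ F, regKernel ξ g (τ h g.src) * η (τ h g.src) := by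
    filter_upwards [hsrc ev1, hsrc ev2] with g h1 h2
    have hinjF : Set.InjOn (fun h => τ h g.src) F := by
      intro a ha b hb hab
      by_contra hne
      refine Set.disjoint_left.1 (hDd ha hb hne) (h1 a ha).1 ?_
      have hab' : τ a g.src = τ b g.src := hab
      rw [hab']
      exact (h1 b hb).1
    rw [← Finset.sum_image (g := fun h => τ h g.src) (f := fun q => regKernel ξ g q * η q) hinjF]
    refine tsum_eq_sum fun q hq => ?_
    by_contra hne
    have hq1 : q.src = g.src :=
      (src_eq_of_regKernel_ne_zero (left_ne_zero_of_mul hne)).symm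
    have hq2 : q ∈ K := subset_tsupport _ (right_ne_zero_of_mul hne)
    obtain ⟨h, hh, hqh⟩ := h2 q hq2 hq1
    refine hq (Finset.mem_image.2 ⟨h, hh, ?_⟩)
    exact hinj h (interior_subset (h1 h hh).2) (interior_subset hqh) ((hτs h _).trans hq1.symm)
  have hlim : Filter.Tendsto
      (fun g : S.Groupoid => ∑ h ∈ F, regKernel ξ g (τ h g.src) * η (τ h g.src)) (𝓝 g₀)
      (𝓝 (∑ h ∈ F, regKernel ξ g₀ (τ h g₀.src) * η (τ h g₀.src))) := by
    refine tendsto_finsetSum _ fun h hh => ?_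
    have hτh : Filter.Tendsto (fun g : S.Groupoid => τ h g.src) (𝓝 g₀) (𝓝 (τ h g₀.src)) := by
      have e : τ h g₀.src = h := by
        have := hτ h
        rwa [hFs h hh] at this
      rw [e]
      exact (hτt' h hh).comp hsrc
    refine Filter.Tendsto.mul ?_ ((η.continuous.tendsto _).comp hτh)
    have hc := tendsto_comp (τ := fun g : S.Groupoid => g) (g := g₀) (h := (τ h g₀.src).inv)
      (hτs h g₀.src).symm (ρ := fun g : S.Groupoid => (τ h g.src).inv)
      (fun g => (hτs h g.src).symm) Filter.tendsto_id
      ((Groupoid.continuous_inv.tendsto _).comp hτh)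
    rw [regKernel_of_eq ξ (hτs h g₀.src).symm]
    refine ((ξ.continuous.tendsto _).comp hc).congr fun g => ?_
    exact (regKernel_of_eq ξ (hτs h g.src).symm).symm
  have h0 := key.self_of_nhds
  rw [ContinuousAt, h0]
  exact hlim.congr' (key.mono fun g hg => hg.symm)

theorem hasCompactSupport_convFun (ξ η : C_c(S.Groupoid, ℂ)) :
    HasCompactSupport (convFun ξ η) := by
  let P := {p : S.Groupoid × S.Groupoid // p.1.src = p.2.rng}
  let μ : P → S.Groupoid := fun p => p.1.1.comp p.1.2 p.2
  have hμ : Continuous μ := by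
    refine continuous_iff_continuousAt.2 fun p => ?_
    exact tendsto_comp p.2 (fun q : P => q.2)
      ((continuous_fst.comp continuous_subtype_val).tendsto p)
      ((continuous_snd.comp continuous_subtype_val).tendsto p)
  have hcl : IsClosed {p : S.Groupoid × S.Groupoid | p.1.src = p.2.rng} :=
    isClosed_eq (continuous_src.comp continuous_fst) (continuous_rng.comp continuous_snd)
  have hK := hcl.isClosedEmbedding_subtypeVal.isCompact_preimage
    (ξ.hasCompactSupport.isCompact.prod η.hasCompactSupport.isCompact)
  refine HasCompactSupport.intro (hK.image hμ) fun g hg => ?_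
  refine (tsum_congr fun h => ?_).trans tsum_zero
  by_contra hne
  have hs := src_eq_of_regKernel_ne_zero (left_ne_zero_of_mul hne)
  have h1 := left_ne_zero_of_mul hne
  rw [regKernel_of_eq ξ hs] at h1
  refine hg ⟨⟨(g.mulInv h hs, h), rfl⟩, ⟨subset_tsupport _ h1,
    subset_tsupport _ (right_ne_zero_of_mul hne)⟩, ?_⟩
  ext <;> simp [μ, mulInv, comp, inv, hs]

/-- Convolution on `C_c(𝒢)`. -/
def conv (ξ η : C_c(S.Groupoid, ℂ)) : C_c(S.Groupoid, ℂ) where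
  toFun := convFun ξ η
  continuous_toFun := continuous_convFun ξ η
  hasCompactSupport' := hasCompactSupport_convFun ξ η

/-- The involution `ξ^*(g) = conj (ξ(g⁻¹))` on `C_c(𝒢)`. -/
def convStar (ξ : C_c(S.Groupoid, ℂ)) : C_c(S.Groupoid, ℂ) where
  toFun g := star (ξ g.inv)
  continuous_toFun := (ξ.continuous.comp Groupoid.continuous_inv).star
  hasCompactSupport' := by
    refine HasCompactSupport.intro (ξ.hasCompactSupport.isCompact.image Groupoid.continuous_inv)
      fun g hg => ?_
    have : ξ g.inv = 0 := by
      by_contra hne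
      exact hg ⟨g.inv, subset_tsupport _ hne, inv_inv g⟩
    rw [this, star_zero]

variable (S) in
/-- The direct sum of the regular representations of `C_c(𝒢)` on the spaces `ℓ²(s⁻¹(x))`, `x ∈ X`,
acting on `ℓ²(𝒢) = ⨁ₓ ℓ²(s⁻¹(x))`: `(λ(ξ) v)(g) = ∑ ξ(g h⁻¹) v(h)`, the sum running over all `h`
with the same source as `g`. -/
def regRep : C_c(S.Groupoid, ℂ) →ₗ[ℂ] EllTwo S.Groupoid →L[ℂ] EllTwo S.Groupoid where
  toFun ξ := ofKernel (regKernel ξ) (isBanded_regKernel ξ)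
  map_add' ξ η := ofKernel_add _ _ _ fun g h => by
    by_cases hs : g.src = h.src
    · simp [regKernel_of_eq _ hs]
    · simp [regKernel_of_ne _ hs]
  map_smul' c ξ := ofKernel_smul c _ _ fun g h => by
    by_cases hs : g.src = h.src
    · simp [regKernel_of_eq _ hs]
    · simp [regKernel_of_ne _ hs]

theorem regRep_apply (ξ : C_c(S.Groupoid, ℂ)) :
    regRep S ξ = ofKernel (regKernel ξ) (isBanded_regKernel ξ) := rfl

theorem regRep_mul (ξ η : C_c(S.Groupoid, ℂ)) :
    regRep S ξ * regRep S η = regRep S (conv ξ η) := by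
  classical
  refine ofKernel_mul (isBanded_regKernel ξ) (isBanded_regKernel η)
    (isBanded_regKernel (conv ξ η)) fun g h => ?_
  by_cases hs : g.src = h.src
  · rw [regKernel_of_eq _ hs]
    change ∑' q, regKernel ξ (g.mulInv h hs) q * η q = _
    -- the substitution `q = k h⁻¹`
    let φ : {k : S.Groupoid // k.src = h.src} → S.Groupoid := fun k => k.1.mulInv h k.2
    have hφ : Function.Injective φ := by
      intro a b hab
      refine Subtype.ext (Groupoid.ext ?_ ?_ ?_)
      · have := congrArg Groupoid.rng hab
        simpa [φ, mulInv, comp, inv] using this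
      · have := congrArg Groupoid.deg hab
        simpa [φ, mulInv, comp, inv] using this
      · exact a.2.trans b.2.symm
    have h1 : Function.support (fun q => regKernel ξ (g.mulInv h hs) q * η q) ⊆ Set.range φ := by
      intro q hq
      have hq1 : h.rng = q.src := src_eq_of_regKernel_ne_zero (left_ne_zero_of_mul hq)
      refine ⟨⟨q.comp h hq1.symm, rfl⟩, ?_⟩
      ext <;> simp [φ, mulInv, comp, inv, hq1]
    have h2 : Function.support (fun k => regKernel ξ g k * regKernel η k h) ⊆
        Set.range (Subtype.val : {k : S.Groupoid // k.src = h.src} → S.Groupoid) := by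
      intro k hk
      exact ⟨⟨k, src_eq_of_regKernel_ne_zero (right_ne_zero_of_mul hk)⟩, rfl⟩
    rw [← hφ.tsum_eq h1, ← Subtype.val_injective.tsum_eq h2]
    refine tsum_congr fun k => ?_
    rw [regKernel_of_eq η k.2, regKernel_of_eq ξ (hs.trans k.2.symm),
      regKernel_of_eq ξ (show (g.mulInv h hs).src = (φ k).src from rfl)]
    congr 2
    ext <;> simp [φ, mulInv, comp, inv]
  · rw [regKernel_of_ne _ hs]
    refine ((tsum_congr fun q => ?_).trans tsum_zero).symm
    by_contra hne
    exact hs ((src_eq_of_regKernel_ne_zero (left_ne_zero_of_mul hne)).trans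
      (src_eq_of_regKernel_ne_zero (right_ne_zero_of_mul hne)))

theorem star_regRep (ξ : C_c(S.Groupoid, ℂ)) : star (regRep S ξ) = regRep S (convStar ξ) := by
  refine star_ofKernel (isBanded_regKernel ξ) (isBanded_regKernel (convStar ξ)) fun g h => ?_
  by_cases hs : g.src = h.src
  · rw [regKernel_of_eq _ hs, regKernel_of_eq _ hs.symm]
    change star (ξ _) = _
    congr 2
    ext <;> simp [mulInv, comp, inv]
  · rw [regKernel_of_ne _ hs, regKernel_of_ne _ (Ne.symm hs), star_zero]

variable (S)

/-- The image of the convolution `*`-algebra `C_c(𝒢)` under the regular representation. -/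
def regAlgebra : NonUnitalStarSubalgebra ℂ (EllTwo S.Groupoid →L[ℂ] EllTwo S.Groupoid) where
  carrier := Set.range (regRep S)
  add_mem' := by
    rintro _ _ ⟨ξ, rfl⟩ ⟨η, rfl⟩
    exact ⟨ξ + η, map_add _ _ _⟩
  zero_mem' := ⟨0, map_zero _⟩
  mul_mem' := by
    rintro _ _ ⟨ξ, rfl⟩ ⟨η, rfl⟩
    exact ⟨conv ξ η, (regRep_mul ξ η).symm⟩
  smul_mem' := by
    rintro c _ ⟨ξ, rfl⟩
    exact ⟨c • ξ, map_smul _ _ _⟩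
  star_mem' := by
    rintro _ ⟨ξ, rfl⟩
    exact ⟨convStar ξ, (star_regRep ξ).symm⟩

/-- The (reduced) C*-algebra of the Deaconu-Renault groupoid: the completion of `C_c(𝒢)` in the
norm `‖ξ‖ = ‖λ(ξ)‖`, realised as the closure of `λ(C_c(𝒢))` in the bounded operators on `ℓ²(𝒢)`. -/
def cstarAlgebra : NonUnitalStarSubalgebra ℂ (EllTwo S.Groupoid →L[ℂ] EllTwo S.Groupoid) :=
  (S.regAlgebra).topologicalClosure

/-- The canonical map `C_c(𝒢) → C*(𝒢)`. -/
def ofCc (ξ : C_c(S.Groupoid, ℂ)) : S.cstarAlgebra :=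
  ⟨regRep S ξ, S.regAlgebra.le_topologicalClosure ⟨ξ, rfl⟩⟩

/-! ### The diagonal -/

variable {S}

theorem Groupoid.continuous_unit : Continuous (unit : X → S.Groupoid) :=
  continuous_iff_continuousAt.2 fun _ => tendsto_nhds_of (m := 0) (n := 0) (by simp [unit])
    ⟨trivial, trivial, rfl⟩ Filter.tendsto_id Filter.tendsto_id
    (Filter.Eventually.of_forall fun _ => ⟨by simp [unit], trivial, trivial, rfl⟩)

theorem Groupoid.isOpen_range_unit : IsOpen (Set.range (unit : X → S.Groupoid)) := by
  have : Set.range (unit : X → S.Groupoid) = Z S Set.univ 0 0 Set.univ := by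
    ext g
    constructor
    · rintro ⟨x, rfl⟩
      exact ⟨trivial, by simp [unit], trivial, trivial, trivial, rfl⟩
    · rintro ⟨-, hd, -, -, -, h⟩
      refine ⟨g.rng, Groupoid.ext rfl ?_ h⟩
      simp [hd, unit]
  rw [this]
  exact isOpen_Z isOpen_univ isOpen_univ 0 0

open Classical in
/-- The extension by zero to `𝒢` of a function in `C_c(X)`, with `X` identified with the unit
space of `𝒢`. -/
def extendZero (f : C_c(X, ℂ)) : C_c(S.Groupoid, ℂ) where
  toFun g := if g = unit g.rng then f g.rng else 0
  continuous_toFun := by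
    refine continuous_iff_continuousAt.2 fun g => ?_
    by_cases hg : g ∈ Set.range (unit : X → S.Groupoid)
    · refine (f.continuous.comp continuous_rng).continuousAt.congr ?_
      filter_upwards [isOpen_range_unit.mem_nhds hg] with h hh
      obtain ⟨x, rfl⟩ := hh
      exact (if_pos rfl).symm
    · have hK : IsCompact (unit '' tsupport f : Set S.Groupoid) :=
        f.hasCompactSupport.isCompact.image continuous_unit
      have hgK : g ∉ (unit '' tsupport f : Set S.Groupoid) := fun h =>
        hg (Set.image_subset_range _ _ h)
      refine (continuousAt_const (y := (0 : ℂ))).congr ?_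
      filter_upwards [hK.isClosed.isOpen_compl.mem_nhds hgK] with h hh
      split_ifs with hu
      · by_contra hne
        exact hh ⟨h.rng, subset_tsupport _ (Ne.symm hne), hu.symm⟩
      · rfl
  hasCompactSupport' := by
    refine HasCompactSupport.intro (f.hasCompactSupport.isCompact.image continuous_unit)
      fun h hh => ?_
    split_ifs with hu
    · by_contra hne
      exact hh ⟨h.rng, subset_tsupport _ hne, hu.symm⟩
    · rfl

theorem exists_bound_comp_rng (f : C₀(X, ℂ)) :
    ∃ C : ℝ, ∀ g : S.Groupoid, ‖f g.rng‖ ≤ C :=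
  ⟨‖f.toBCF‖, fun g => f.toBCF.norm_coe_le_norm g.rng⟩

/-- On `C_c(X)`, multiplication by `f ∘ r` is the operator of the extension by zero of `f`. -/
theorem regRep_extendZero (f : C_c(X, ℂ)) (hf : ∃ C : ℝ, ∀ g : S.Groupoid, ‖f g.rng‖ ≤ C) :
    regRep S (extendZero f) = mulOp (fun g => f g.rng) hf := by
  refine ofKernel_congr (isBanded_regKernel _) (isBanded_diagKernel hf) fun g h => ?_
  unfold diagKernel
  by_cases hs : g.src = h.src
  · rw [regKernel_of_eq _ hs]
    change (open Classical in if g.mulInv h hs = unit (g.mulInv h hs).rng then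
      f (g.mulInv h hs).rng else 0) = _
    by_cases hgh : g = h
    · subst hgh
      rw [if_pos rfl, if_pos]
      · rfl
      · ext <;> simp [mulInv, comp, inv, unit]
    · rw [if_neg hgh, if_neg]
      intro hu
      refine hgh (Groupoid.ext ?_ ?_ hs)
      · exact (congrArg Groupoid.src hu).symm
      · have := congrArg Groupoid.deg hu
        simp only [mulInv, comp, inv, unit] at this
        omega
  · rw [regKernel_of_ne _ hs, if_neg fun hgh => hs (congrArg Groupoid.src hgh)]

theorem exists_cc_approx (f : C₀(X, ℂ)) {ε : ℝ} (hε : 0 < ε) :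
    ∃ f' : C_c(X, ℂ), ∀ x, ‖f x - f' x‖ ≤ ε := by
  set c : X → ℂ := fun x => ((max 0 (1 - ε / max ε ‖f x‖) : ℝ) : ℂ) with hc
  have hpos : ∀ x, 0 < max ε ‖f x‖ := fun x => lt_max_of_lt_left hε
  have hcc : Continuous c := by
    refine Complex.continuous_ofReal.comp (continuous_const.max (continuous_const.sub ?_))
    exact continuous_const.div (continuous_const.max f.continuous.norm) fun x => (hpos x).ne'
  have hK : ∃ K : Set X, IsCompact K ∧ ∀ x ∉ K, ‖f x‖ < ε := by
    have h1 := f.zero_at_infty'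
    have h2 := h1 (Metric.ball_mem_nhds (0 : ℂ) hε)
    obtain ⟨K, hK, hKs⟩ := Filter.mem_cocompact.1 h2
    exact ⟨K, hK, fun x hx => by simpa using hKs hx⟩
  obtain ⟨K, hK, hKs⟩ := hK
  refine ⟨⟨⟨fun x => f x * c x, f.continuous.mul hcc⟩, HasCompactSupport.intro hK fun x hx => ?_⟩,
    fun x => ?_⟩
  · have : max ε ‖f x‖ = ε := max_eq_left (hKs x hx).le
    simp [hc, this, hε.ne']
  · change ‖f x - f x * c x‖ ≤ ε
    have h1 : ε / max ε ‖f x‖ ≤ 1 := (div_le_one (hpos x)).2 (le_max_left _ _)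
    have h2 : f x - f x * c x = f x * ((ε / max ε ‖f x‖ : ℝ) : ℂ) := by
      simp only [hc, max_eq_right (sub_nonneg.2 h1)]
      push_cast
      ring
    rw [h2, norm_mul, Complex.norm_real, Real.norm_of_nonneg (div_nonneg hε.le (hpos x).le)]
    rw [mul_div_assoc', div_le_iff₀ (hpos x), mul_comm]
    gcongr
    exact le_max_right _ _

theorem mulOp_mem_cstarAlgebra (f : C₀(X, ℂ)) :
    mulOp (fun g : S.Groupoid => f g.rng) (exists_bound_comp_rng f) ∈ S.cstarAlgebra := by
  refine Metric.mem_closure_iff.2 fun ε hε => ?_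
  obtain ⟨f', hf'⟩ := exists_cc_approx f (half_pos hε)
  have hb : ∃ C : ℝ, ∀ g : S.Groupoid, ‖f' g.rng‖ ≤ C := by
    obtain ⟨C, hC⟩ := f'.hasCompactSupport.exists_bound_of_continuous f'.continuous
    exact ⟨C, fun g => hC _⟩
  refine ⟨regRep S (extendZero f'), ⟨_, rfl⟩, ?_⟩
  rw [regRep_extendZero f' hb, dist_eq_norm]
  exact (norm_mulOp_sub_le _ _ (half_pos hε).le fun g => hf' _).trans_lt (half_lt_self hε)

variable (S) in
/-- The inclusion `C₀(X) ⊆ C*(𝒢)`. It is the continuous extension of the map that sends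
`f ∈ C_c(X)` to the extension by zero of `f` to `𝒢`, and sends `f` to multiplication by `f ∘ r`. -/
def diagonal : C₀(X, ℂ) →⋆ₙₐ[ℂ] S.cstarAlgebra where
  toFun f := ⟨mulOp (fun g => f g.rng) (exists_bound_comp_rng f), mulOp_mem_cstarAlgebra f⟩
  map_smul' c f := Subtype.ext (mulOp_smul c (exists_bound_comp_rng f)
    (exists_bound_comp_rng (c • f)) fun _ => rfl)
  map_zero' := Subtype.ext ((mulOp_smul 0 (exists_bound_comp_rng 0)
    (exists_bound_comp_rng 0) fun _ => by simp).trans (zero_smul ℂ _))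
  map_add' f f' := Subtype.ext (mulOp_add (exists_bound_comp_rng f) (exists_bound_comp_rng f')
    (exists_bound_comp_rng (f + f')) fun _ => rfl)
  map_mul' f f' := Subtype.ext (mulOp_mul (exists_bound_comp_rng f) (exists_bound_comp_rng f')
    (exists_bound_comp_rng (f * f')) fun _ => rfl).symm
  map_star' f := Subtype.ext (star_mulOp (exists_bound_comp_rng f)
    (exists_bound_comp_rng (star f)) fun _ => rfl).symm

theorem diagonal_of_compactSupport (f : C_c(X, ℂ)) :
    S.diagonal (f : C₀(X, ℂ)) = S.ofCc (extendZero f) :=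
  Subtype.ext (regRep_extendZero f (exists_bound_comp_rng (S := S) (f : C₀(X, ℂ)))).symm

/-! ### Cocycles and weighted actions -/

section Weighted

variable {Γ : Type*} [CommGroup Γ]

variable (S) in
/-- `f⁽ᵏ⁾(x) = f(x) f(σ(x)) ⋯ f(σᵏ⁻¹(x))`, for `x ∈ dom σᵏ`, with `Γ` written multiplicatively. -/
def iterProd (f : X → Γ) (k : ℕ) (x : X) : Γ := ∏ i ∈ Finset.range k, f (S.σ^[i] x)

/-- The cocycle `c_f(x, m - n, y) = f⁽ᵐ⁾(x) / f⁽ⁿ⁾(y)`, where `σᵐ(x) = σⁿ(y)`; the value does not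
depend on the choice of `m` and `n`, see `cocycle_eq`. -/
def cocycle (f : X → Γ) (g : S.Groupoid) : Γ :=
  S.iterProd f g.exists_tailEq.choose g.rng /
    S.iterProd f g.exists_tailEq.choose_spec.choose g.src

theorem iterProd_div_add (f : X → Γ) {m n : ℕ} {x y : X} (h : S.TailEq m n x y) (k : ℕ) :
    S.iterProd f (m + k) x / S.iterProd f (n + k) y = S.iterProd f m x / S.iterProd f n y := by
  unfold iterProd
  rw [Finset.prod_range_add, Finset.prod_range_add]
  have : ∀ i, S.σ^[m + i] x = S.σ^[n + i] y := fun i => by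
    rw [Nat.add_comm m i, Nat.add_comm n i, Function.iterate_add_apply,
      Function.iterate_add_apply, h.2.2]
  simp_rw [this]
  exact mul_div_mul_right_eq_div _ _ _

theorem iterProd_div_eq (f : X → Γ) {m n m' n' : ℕ} {x y : X} (h : S.TailEq m n x y)
    (h' : S.TailEq m' n' x y) (hd : (m : ℤ) - n = m' - n') :
    S.iterProd f m x / S.iterProd f n y = S.iterProd f m' x / S.iterProd f n' y := by
  rcases le_total m m' with hm | hm
  · obtain ⟨k, rfl⟩ := Nat.exists_eq_add_of_le hm
    obtain rfl : n' = n + k := by push_cast at hd; omega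
    exact (iterProd_div_add f h k).symm
  · obtain ⟨k, rfl⟩ := Nat.exists_eq_add_of_le hm
    obtain rfl : n = n' + k := by push_cast at hd; omega
    exact iterProd_div_add f h' k

theorem cocycle_eq (f : X → Γ) {g : S.Groupoid} {m n : ℕ} (hd : g.deg = m - n)
    (ht : S.TailEq m n g.rng g.src) :
    cocycle f g = S.iterProd f m g.rng / S.iterProd f n g.src := by
  obtain ⟨hd', ht'⟩ := g.exists_tailEq.choose_spec.choose_spec
  exact iterProd_div_eq f ht' ht (hd'.symm.trans hd)

theorem cocycle_comp (f : X → Γ) (g h : S.Groupoid) (hgh : g.src = h.rng) :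
    cocycle f (g.comp h hgh) = cocycle f g * cocycle f h := by
  obtain ⟨a, b, e, t⟩ := g.exists_tailEq
  obtain ⟨c, d, e', t'⟩ := h.exists_tailEq
  rw [← hgh] at t'
  obtain ⟨a', b', d', e1, e2, t1, t2⟩ := t.trans t'
  rw [cocycle_eq f (g := g) (e.trans e1.symm) t1,
    cocycle_eq f (g := h) (e'.trans e2.symm) (hgh ▸ t2),
    cocycle_eq f (g := g.comp h hgh) (m := a') (n := d')
      (by simp only [comp, e, e', ← e1, ← e2]; ring) ⟨t1.1, t2.2.1, t1.2.2.trans t2.2.2⟩, hgh]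
  exact (div_mul_div_cancel _ _ _).symm

theorem cocycle_inv (f : X → Γ) (g : S.Groupoid) : cocycle f g.inv = (cocycle f g)⁻¹ := by
  obtain ⟨m, n, e, t⟩ := g.exists_tailEq
  rw [cocycle_eq f e t, cocycle_eq f (g := g.inv) (m := n) (n := m) (by simp [inv, e]) t.symm,
    inv_div]
  rfl

variable [TopologicalSpace Γ] [IsTopologicalGroup Γ]

theorem continuousAt_iterProd (f : C(X, Γ)) {k : ℕ} {x : X} (hx : x ∈ S.domIter k) :
    ContinuousAt (S.iterProd f k) x := by
  refine tendsto_finsetProd _ fun i hi => ?_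
  obtain ⟨j, rfl⟩ := Nat.exists_eq_add_of_le (Finset.mem_range.1 hi).le
  have hxi := ((S.mem_domIter_add i j x).1 hx).1
  exact (f.continuous.tendsto _).comp ((S.isLocalHomeomorphOn_iterate i).2.continuousAt hxi)

theorem continuous_cocycle (f : C(X, Γ)) : Continuous (cocycle f : S.Groupoid → Γ) := by
  refine continuous_iff_continuousAt.2 fun g => ?_
  obtain ⟨m, n, hd, ht⟩ := g.exists_tailEq
  have h1 : ContinuousAt (fun h : S.Groupoid => S.iterProd f m h.rng / S.iterProd f n h.src) g :=
    ((continuousAt_iterProd f ht.1).comp continuous_rng.continuousAt).div'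
      ((continuousAt_iterProd f ht.2.1).comp continuous_src.continuousAt)
  refine h1.congr ?_
  filter_upwards [Z_mem_nhds hd ht] with h hh
  exact (cocycle_eq f hh.2.1 hh.2.2.2).symm

/-- The function `g ↦ χ(c_f(g))`, complex-valued. -/
def weight (f : C(X, Γ)) (χ : PontryaginDual Γ) (g : S.Groupoid) : ℂ := (χ (cocycle f g) : ℂ)

theorem exists_bound_weight (f : C(X, Γ)) (χ : PontryaginDual Γ) :
    ∃ C : ℝ, ∀ g : S.Groupoid, ‖weight f χ g‖ ≤ C :=
  ⟨1, fun _ => (Circle.norm_coe _).le⟩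

/-- The function `g ↦ χ(c_f(g)) ξ(g)` in `C_c(𝒢)`. -/
def weightCc (f : C(X, Γ)) (χ : PontryaginDual Γ) (ξ : C_c(S.Groupoid, ℂ)) :
    C_c(S.Groupoid, ℂ) where
  toFun g := (χ (cocycle f g) : ℂ) * ξ g
  continuous_toFun := by
    have h1 : Continuous fun g : S.Groupoid => χ (cocycle f g) :=
      (map_continuous χ).comp (continuous_cocycle f)
    have h2 : Continuous fun z : Circle => (z : ℂ) := by fun_prop
    exact (h2.comp h1).mul ξ.continuous
  hasCompactSupport' := ξ.hasCompactSupport.mul_left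

variable (S) in
/-- The unitaries of multiplication by `χ ∘ c_f` on `ℓ²(𝒢)`, for `χ` in the dual of `Γ`. -/
def weightUnitary (f : C(X, Γ)) :
    PontryaginDual Γ →* unitary (EllTwo S.Groupoid →L[ℂ] EllTwo S.Groupoid) where
  toFun χ := ⟨mulOp (weight f χ) (exists_bound_weight f χ), by
    have hs : star (mulOp (weight (S := S) f χ) (exists_bound_weight f χ)) =
        mulOp (weight f χ⁻¹) (exists_bound_weight f χ⁻¹) :=
      star_mulOp _ (exists_bound_weight f χ⁻¹) fun g => Circle.coe_inv_eq_conj _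
    have h1 : mulOp (fun _ : S.Groupoid => (1 : ℂ)) ⟨1, fun _ => by simp⟩ = 1 :=
      ContinuousLinearMap.ext fun v => lp.ext <| funext fun g => by
        rw [mulOp_apply, one_mul]
        rfl
    rw [Unitary.mem_iff, hs, mulOp_mul (exists_bound_weight f χ⁻¹) (exists_bound_weight f χ)
        ⟨1, fun _ => by simp⟩ (c := fun _ => 1) fun g => ?_,
      mulOp_mul (exists_bound_weight f χ) (exists_bound_weight f χ⁻¹)
        ⟨1, fun _ => by simp⟩ (c := fun _ => 1) fun g => ?_]
    · exact ⟨h1, h1⟩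
    · change (1 : ℂ) = (χ (cocycle f g) : ℂ) * ((χ (cocycle f g))⁻¹ : Circle)
      rw [← Circle.coe_mul, mul_inv_cancel, Circle.coe_one]
    · change (1 : ℂ) = ((χ (cocycle f g))⁻¹ : Circle) * (χ (cocycle f g) : ℂ)
      rw [← Circle.coe_mul, inv_mul_cancel, Circle.coe_one]⟩
  map_one' := Subtype.ext <| ContinuousLinearMap.ext fun v => lp.ext <| funext fun g => by
    change mulOp (weight f 1) (exists_bound_weight f 1) v g = v g
    simp [mulOp_apply, weight]
  map_mul' χ ψ := Subtype.ext (mulOp_mul (exists_bound_weight f χ) (exists_bound_weight f ψ)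
    (exists_bound_weight f (χ * ψ)) fun g => Circle.coe_mul _ _).symm

theorem conj_weightUnitary_regRep (f : C(X, Γ)) (χ : PontryaginDual Γ) (ξ : C_c(S.Groupoid, ℂ)) :
    Unitary.conjStarAlgAut ℂ _ (S.weightUnitary f χ) (regRep S ξ) = regRep S (weightCc f χ ξ) := by
  have hs : star (mulOp (weight (S := S) f χ) (exists_bound_weight f χ)) =
      mulOp (weight f χ⁻¹) (exists_bound_weight f χ⁻¹) :=
    star_mulOp _ (exists_bound_weight f χ⁻¹) fun g => Circle.coe_inv_eq_conj _
  rw [Unitary.conjStarAlgAut_apply]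
  change mulOp (weight f χ) (exists_bound_weight f χ) * regRep S ξ *
    star (mulOp (weight f χ) (exists_bound_weight f χ)) = _
  rw [hs]
  refine mulOp_mul_ofKernel_mul_mulOp (exists_bound_weight f χ) (exists_bound_weight f χ⁻¹)
    (isBanded_regKernel ξ) (isBanded_regKernel (weightCc f χ ξ)) fun g h => ?_
  by_cases hs : g.src = h.src
  · rw [regKernel_of_eq _ hs, regKernel_of_eq _ hs]
    change (χ (cocycle f (g.mulInv h hs)) : ℂ) * ξ (g.mulInv h hs) =
      (χ (cocycle f g) : ℂ) * ξ (g.mulInv h hs) * ((χ (cocycle f h))⁻¹ : Circle)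
    rw [mulInv, cocycle_comp, cocycle_inv, map_mul, map_inv, Circle.coe_mul]
    ring
  · simp [regKernel_of_ne _ hs]

theorem conj_weightUnitary_mem (f : C(X, Γ)) (χ : PontryaginDual Γ)
    {T : EllTwo S.Groupoid →L[ℂ] EllTwo S.Groupoid} (hT : T ∈ S.cstarAlgebra) :
    Unitary.conjStarAlgAut ℂ _ (S.weightUnitary f χ) T ∈ S.cstarAlgebra := by
  have hc : Continuous fun T : EllTwo S.Groupoid →L[ℂ] EllTwo S.Groupoid =>
      Unitary.conjStarAlgAut ℂ _ (S.weightUnitary f χ) T := by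
    simp only [Unitary.conjStarAlgAut_apply]
    exact (continuous_const.mul continuous_id).mul continuous_const
  refine map_mem_closure hc hT ?_
  rintro _ ⟨ξ, rfl⟩
  exact ⟨weightCc f χ ξ, (conj_weightUnitary_regRep f χ ξ).symm⟩

variable (S) in
/-- The weighted action of the dual of `Γ` on `C*(𝒢)` by `*`-automorphisms that is associated to
`f ∈ C(X, Γ)`. By `weightedAction_ofCc` below, it is the continuous extension of
`ξ ↦ (g ↦ χ(c_f(g)) ξ(g))`, `ξ ∈ C_c(𝒢)`; it is implemented by conjugation with the unitaries of
multiplication by `χ ∘ c_f`. -/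
def weightedAction (f : C(X, Γ)) : PontryaginDual Γ →* (S.cstarAlgebra ≃⋆ₐ[ℂ] S.cstarAlgebra) where
  toFun χ :=
    { toFun := fun a => ⟨Unitary.conjStarAlgAut ℂ _ (S.weightUnitary f χ) a,
        conj_weightUnitary_mem f χ a.2⟩
      invFun := fun a => ⟨Unitary.conjStarAlgAut ℂ _ (S.weightUnitary f χ⁻¹) a,
        conj_weightUnitary_mem f χ⁻¹ a.2⟩
      left_inv := fun a => Subtype.ext <| by
        change Unitary.conjStarAlgAut ℂ _ (S.weightUnitary f χ⁻¹)
          (Unitary.conjStarAlgAut ℂ _ (S.weightUnitary f χ) (a : _ →L[ℂ] _)) = a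
        rw [← StarAlgEquiv.mul_apply, ← map_mul, ← map_mul, inv_mul_cancel, map_one, map_one]
        rfl
      right_inv := fun a => Subtype.ext <| by
        change Unitary.conjStarAlgAut ℂ _ (S.weightUnitary f χ)
          (Unitary.conjStarAlgAut ℂ _ (S.weightUnitary f χ⁻¹) (a : _ →L[ℂ] _)) = a
        rw [← StarAlgEquiv.mul_apply, ← map_mul, ← map_mul, mul_inv_cancel, map_one, map_one]
        rfl
      map_mul' := fun a b => Subtype.ext (map_mul _ _ _)
      map_add' := fun a b => Subtype.ext (map_add _ _ _)
      map_star' := fun a => Subtype.ext (map_star _ _)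
      map_smul' := fun c a => Subtype.ext (map_smul _ _ _) }
  map_one' := StarAlgEquiv.ext fun a => Subtype.ext <| by
    change Unitary.conjStarAlgAut ℂ _ (S.weightUnitary f 1) (a : _ →L[ℂ] _) = a
    rw [map_one, map_one]
    rfl
  map_mul' χ ψ := StarAlgEquiv.ext fun a => Subtype.ext <| by
    change Unitary.conjStarAlgAut ℂ _ (S.weightUnitary f (χ * ψ)) (a : _ →L[ℂ] _) =
      Unitary.conjStarAlgAut ℂ _ (S.weightUnitary f χ)
        (Unitary.conjStarAlgAut ℂ _ (S.weightUnitary f ψ) (a : _ →L[ℂ] _))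
    rw [map_mul, map_mul]
    rfl

theorem weightedAction_ofCc (f : C(X, Γ)) (χ : PontryaginDual Γ) (ξ : C_c(S.Groupoid, ℂ)) :
    S.weightedAction f χ (S.ofCc ξ) = S.ofCc (weightCc f χ ξ) :=
  Subtype.ext (conj_weightUnitary_regRep f χ ξ)

variable (S) in
/-- The elements of `C*(𝒢)` that are fixed by the whole weighted action associated to `f`. -/
def fixedPoints (f : C(X, Γ)) : Set S.cstarAlgebra :=
  {a | ∀ χ : PontryaginDual Γ, S.weightedAction f χ a = a}

end Weighted

end DeaconuRenaultSystem

/-- `Γ` is separating for `X` if, for all finite `F ⊆ X` and `x ∈ X \ F`, there is a continuous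
`f : X → Γ` such that `f(x)` has infinite order and `f` is the identity element on `F`. -/
def IsSeparating (Γ X : Type*) [Group Γ] [TopologicalSpace Γ] [TopologicalSpace X] : Prop :=
  ∀ (F : Finset X) (x : X), x ∉ F →
    ∃ f : C(X, Γ), ¬ IsOfFinOrder (f x) ∧ ∀ y ∈ F, f y = 1

end

/-!
An operator `a` in `C*(𝒢)` on `ℓ²(𝒢)` is determined by its matrix entries, and its entry at `(g, h)`
vanishes unless `g` and `h` have the same source, in which case it depends only on `g h⁻¹`: this
holds on `C_c(𝒢)` and passes to the closure. The weighted action of `χ` multiplies this entry by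
`χ(c_f(g h⁻¹))` (`matrixEntry_weightedAction`). Elements of `C₀(X)` act as diagonal operators,
hence are fixed. Conversely, if `a` is fixed by all weighted actions and its entry at `(g, h)` is
nonzero, then every character is trivial at `c_f(g h⁻¹)`, for every `f`. Two facts then force
`g = h`.

* Characters separate the points of `Γ` (`exists_pontryaginDual_apply_ne_one`), so `c_f(g h⁻¹) = 1`.
  To obtain characters, integrate the regular representation of `Γ` on `L²(Γ)` against a function in
  `C_c(Γ)` (`smear`), and apply Gelfand duality to the commutative C*-algebra generated by the
  representation and the resulting operator; the latter makes the characters continuous.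
* If `c_f = 1` at some groupoid element for all `f`, that element is a unit
  (`eq_unit_of_forall_cocycle_eq_one`). This is where `Γ` is separating: the values of `f` at
  different points of the two orbit segments can be told apart, so both segments visit the same
  points with the same multiplicities, and then they have the same starting point
  (`eq_of_map_iterate_range_eq`).

So `a` is diagonal, and its diagonal is the restriction of `a` to the unit space, a uniform limit of
functions in `C_c(X)` (`exists_zeroAtInfty_diagonalEntry`).
-/

/-! ### Characters of locally compact abelian groups -/

section Characters

open MeasureTheory
open scoped Pointwise

/-- Let `U` be a unitary representation in a C*-algebra of an abelian group, and let `a` be a normal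
element commuting with it such that `x ↦ U x * a` is norm continuous. If `U g * a ≠ a`, some
continuous character is nontrivial at `g`. By Gelfand duality, the commutative C*-algebra generated
by `a` and the `U x` has a character `φ` with `φ (U g * a) ≠ φ a`, and `φ ∘ U` does it: it is
continuous because `φ (U x) = φ (U x * a) / φ a`. -/
theorem exists_pontryaginDual_apply_ne_one_of_cstarAlgebra {G A : Type*} [CommGroup G]
    [TopologicalSpace G] [IsTopologicalGroup G] [CStarAlgebra A] (U : G →* unitary A) (a : A)
    [IsStarNormal a] (hcomm : ∀ x, (U x : A) * a = a * U x)
    (hcont : Continuous fun x => (U x : A) * a) {g : G}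
    (hg : (U g : A) * a ≠ a) : ∃ χ : PontryaginDual G, χ g ≠ 1 := by
  have hstar : ∀ x, star (U x : A) = U x⁻¹ := fun x => by
    rw [map_inv, ← Unitary.coe_star, Unitary.star_eq_inv]
  have hUU : ∀ x y, (U x : A) * U y = U y * U x := fun x y => by
    rw [← Submonoid.coe_mul, ← Submonoid.coe_mul, ← map_mul, ← map_mul, mul_comm]
  set s : Set A := insert a (Set.range fun x => (U x : A)) with hs
  have h1 : ∀ b ∈ s, ∀ c ∈ s, b * c = c * b := by
    rintro _ (rfl | ⟨x, rfl⟩) _ (rfl | ⟨y, rfl⟩)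
    · rfl
    · exact (hcomm y).symm
    · exact hcomm x
    · exact hUU x y
  have h2 : ∀ b ∈ s, ∀ c ∈ s, b * star c = star c * b := by
    rintro _ (rfl | ⟨x, rfl⟩) _ (rfl | ⟨y, rfl⟩)
    · exact (star_comm_self' _).symm
    · simp only [hstar, hcomm]
    · have := congrArg star (hcomm x⁻¹)
      simpa only [star_mul, hstar, inv_inv] using this.symm
    · simp only [hstar, hUU]
  have hadj := StarAlgebra.isMulCommutative_adjoin ℂ h1 h2
  let B := (StarAlgebra.adjoin ℂ s).topologicalClosure
  have hB : IsClosed (B : Set A) := StarSubalgebra.isClosed_topologicalClosure _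
  let _ : CommCStarAlgebra B :=
    { (inferInstance : CStarAlgebra B) with
      mul_comm := (StarSubalgebra.commRingTopologicalClosure (StarAlgebra.adjoin ℂ s)
        fun x y => hadj.is_comm.comm x y).mul_comm }
  have hsB : s ⊆ B := (StarAlgebra.subset_adjoin ℂ s).trans
    (StarSubalgebra.le_topologicalClosure _)
  let u : G → B := fun x => ⟨U x, hsB (Or.inr ⟨x, rfl⟩)⟩
  let b : B := ⟨a, hsB (Or.inl rfl)⟩
  have hb : u g * b - b ≠ 0 := fun h => hg (congrArg Subtype.val (sub_eq_zero.1 h))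
  obtain ⟨φ, hφ⟩ : ∃ φ : WeakDual.characterSpace ℂ B, φ (u g * b - b) ≠ 0 := by
    by_contra! h
    refine hb ((gelfandTransform_isometry B).injective ?_)
    rw [map_zero]
    exact ContinuousMap.ext h
  rw [map_sub, map_mul] at hφ
  have hφb : φ b ≠ 0 := fun h => hφ (by rw [h, mul_zero, sub_zero])
  have hu1 : u 1 = 1 := Subtype.ext (by simp [u])
  have hmul : ∀ x y, u (x * y) = u x * u y := fun x y => Subtype.ext (by simp [u])
  have hmem : ∀ x, φ (u x) ∈ Submonoid.unitSphere ℂ := fun x => by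
    have h3 : star (u x) * u x = 1 := Subtype.ext (Unitary.coe_star_mul_self (U x))
    have h4 := congrArg φ h3
    rw [map_mul, map_star, map_one] at h4
    have h5 : ‖φ (u x)‖ * ‖φ (u x)‖ = 1 := by
      rw [← CStarRing.norm_star_mul_self, h4, norm_one]
    exact mem_sphere_zero_iff_norm.2 ((mul_self_eq_one_iff.1 h5).resolve_right
      fun h => by linarith [norm_nonneg (φ (u x))])
  have hφc : Continuous fun x => φ (u x) := by
    have h3 : Continuous fun x => u x * b := Continuous.subtype_mk hcont _
    have h4 : Continuous fun x => φ (u x * b) / φ b :=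
      ((map_continuous φ).comp h3).div_const _
    refine h4.congr fun x => ?_
    rw [map_mul, mul_div_cancel_right₀ _ hφb]
  let χ : PontryaginDual G :=
    { toFun := fun x => ⟨φ (u x), hmem x⟩
      map_one' := Subtype.ext (show φ (u 1) = 1 by rw [hu1, map_one])
      map_mul' := fun x y => Subtype.ext
        (show φ (u (x * y)) = φ (u x) * φ (u y) by rw [hmul, map_mul])
      continuous_toFun := hφc.subtype_mk _ }
  refine ⟨χ, fun h => hφ ?_⟩
  have h5 : φ (u g) = 1 := congrArg Subtype.val h
  rw [h5, one_mul, sub_self]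

theorem tendsto_integral_norm_translate_sub {G : Type*} [Group G] [TopologicalSpace G]
    [IsTopologicalGroup G] [LocallyCompactSpace G] [MeasurableSpace G] [BorelSpace G]
    (μ : Measure G) [IsFiniteMeasureOnCompacts μ] {f : G → ℂ} (hf : Continuous f)
    (hfc : HasCompactSupport f) :
    Filter.Tendsto (fun y => ∫ x, ‖f (y⁻¹ * x) - f x‖ ∂μ) (𝓝 1) (𝓝 0) := by
  obtain ⟨V, hV, hV1⟩ := exists_compact_mem_nhds (1 : G)
  have hk : IsCompact (V * tsupport f ∪ tsupport f) := (hV.mul hfc).union hfc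
  have h1 := continuousOn_integral_of_compact_support (μ := μ)
    (f := fun y x => ‖f (y⁻¹ * x) - f x‖) (s := V) hk (by fun_prop) ?_
  · have h2 := h1.continuousAt hV1
    simpa [ContinuousAt] using h2
  · intro y x hy hx
    have h3 : f x = 0 := image_eq_zero_of_notMem_tsupport fun h => hx (Or.inr h)
    have h4 : f (y⁻¹ * x) = 0 := image_eq_zero_of_notMem_tsupport fun h =>
      hx (Or.inl ⟨y, hy, _, h, by simp⟩)
    simp [h3, h4]

theorem integrable_smul_unitary {G H : Type*} [Group G] [TopologicalSpace G] [MeasurableSpace G]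
    [BorelSpace G] [NormedAddCommGroup H] [InnerProductSpace ℂ H] [CompleteSpace H] (μ : Measure G)
    [IsFiniteMeasureOnCompacts μ] {U : G →* unitary (H →L[ℂ] H)}
    (hU : ∀ v, Continuous fun x => (U x : H →L[ℂ] H) v) (f : C_c(G, ℂ)) (v : H) :
    Integrable (fun x => f x • (U x : H →L[ℂ] H) v) μ :=
  (f.continuous.smul (hU v)).integrable_of_hasCompactSupport f.hasCompactSupport.smul_right

/-- The operator `∫ f(x) U(x) dμ(x)`, defined in the strong operator topology, of a strongly
continuous unitary representation `U` and `f ∈ C_c(G)`. -/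
noncomputable def smear {G H : Type*} [Group G] [TopologicalSpace G] [MeasurableSpace G]
    [BorelSpace G] [NormedAddCommGroup H] [InnerProductSpace ℂ H] [CompleteSpace H] (μ : Measure G)
    [IsFiniteMeasureOnCompacts μ] {U : G →* unitary (H →L[ℂ] H)}
    (hU : ∀ v, Continuous fun x => (U x : H →L[ℂ] H) v) (f : C_c(G, ℂ)) : H →L[ℂ] H :=
  LinearMap.mkContinuous
    { toFun := fun v => ∫ x, f x • (U x : H →L[ℂ] H) v ∂μ
      map_add' := fun v w => by
        simp only [map_add, smul_add]
        exact integral_add (integrable_smul_unitary μ hU f v) (integrable_smul_unitary μ hU f w)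
      map_smul' := fun c v => by
        simp only [map_smul, smul_comm _ c, integral_smul, RingHom.id_apply] }
    (∫ x, ‖f x‖ ∂μ) fun v => by
      refine (norm_integral_le_integral_norm _).trans_eq ?_
      rw [← integral_mul_const]
      refine integral_congr_ae (Filter.Eventually.of_forall fun x => ?_)
      simp only [norm_smul, ContinuousLinearMap.norm_map_of_mem_unitary (U x).2]

section Smear

variable {G H : Type*} [CommGroup G] [TopologicalSpace G] [MeasurableSpace G] [BorelSpace G]
  [NormedAddCommGroup H] [InnerProductSpace ℂ H] [CompleteSpace H] (μ : Measure G)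
  [IsFiniteMeasureOnCompacts μ] {U : G →* unitary (H →L[ℂ] H)}
  (hU : ∀ v, Continuous fun x => (U x : H →L[ℂ] H) v)

theorem smear_apply (f : C_c(G, ℂ)) (v : H) :
    smear μ hU f v = ∫ x, f x • (U x : H →L[ℂ] H) v ∂μ := rfl

theorem commute_smear {T : H →L[ℂ] H} (hT : ∀ x, Commute T (U x)) (f : C_c(G, ℂ)) :
    Commute T (smear μ hU f) := by
  refine ContinuousLinearMap.ext fun v => ?_
  change T (smear μ hU f v) = smear μ hU f (T v)
  rw [smear_apply, smear_apply,
    ← ContinuousLinearMap.integral_comp_comm T (integrable_smul_unitary μ hU f v)]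
  refine integral_congr_ae (Filter.Eventually.of_forall fun x => ?_)
  change T (f x • (U x : H →L[ℂ] H) v) = f x • (U x : H →L[ℂ] H) (T v)
  rw [map_smul]
  exact congrArg (f x • ·) (DFunLike.congr_fun (hT x) v)

theorem commute_unitary_smear (f : C_c(G, ℂ)) (x : G) :
    Commute (U x : H →L[ℂ] H) (smear μ hU f) :=
  commute_smear μ hU (fun y => congrArg Subtype.val ((Commute.all x y).map U)) f

/-- The smeared operator commutes with all that commutes with `U`, such as its own adjoint. -/
theorem isStarNormal_smear (f : C_c(G, ℂ)) : IsStarNormal (smear μ hU f) := by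
  refine ⟨commute_smear μ hU (fun x => ?_) f⟩
  have h := (commute_unitary_smear μ hU f x⁻¹).star_star
  rw [← Unitary.coe_star, map_inv, ← Unitary.star_eq_inv, star_star] at h
  exact h.symm

/-- Unlike `U` itself, `y ↦ U(y) ∫ f(x) U(x) dx = ∫ f(y⁻¹ x) U(x) dx` is norm continuous. -/
theorem continuous_unitary_mul_smear [IsTopologicalGroup G] [LocallyCompactSpace G]
    [μ.IsMulLeftInvariant] (f : C_c(G, ℂ)) :
    Continuous fun y => (U y : H →L[ℂ] H) * smear μ hU f := by
  have hbound : ∀ y, ‖(U y : H →L[ℂ] H) * smear μ hU f - smear μ hU f‖ ≤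
      ∫ x, ‖f (y⁻¹ * x) - f x‖ ∂μ := fun y => by
    refine ContinuousLinearMap.opNorm_le_bound _ (integral_nonneg fun _ => norm_nonneg _)
      fun v => ?_
    have h1 : Integrable (fun x => f (y⁻¹ * x) • (U x : H →L[ℂ] H) v) μ :=
      ((f.continuous.comp (continuous_const_mul y⁻¹)).smul (hU v)).integrable_of_hasCompactSupport
        (f.hasCompactSupport.comp_homeomorph (Homeomorph.mulLeft y⁻¹)).smul_right
    have h2 : (U y : H →L[ℂ] H) (smear μ hU f v) =
        ∫ x, f (y⁻¹ * x) • (U x : H →L[ℂ] H) v ∂μ := by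
      rw [smear_apply,
        ← ContinuousLinearMap.integral_comp_comm _ (integrable_smul_unitary μ hU f v),
        ← integral_mul_left_eq_self (fun x => f (y⁻¹ * x) • (U x : H →L[ℂ] H) v) y]
      refine integral_congr_ae (Filter.Eventually.of_forall fun x => ?_)
      simp only [map_smul, inv_mul_cancel_left, map_mul]
      rfl
    change ‖(U y : H →L[ℂ] H) (smear μ hU f v) - smear μ hU f v‖ ≤ _
    rw [h2, smear_apply, ← integral_sub h1 (integrable_smul_unitary μ hU f v)]
    refine (norm_integral_le_integral_norm _).trans_eq ?_
    rw [← integral_mul_const]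
    refine integral_congr_ae (Filter.Eventually.of_forall fun x => ?_)
    simp only [← sub_smul, norm_smul, ContinuousLinearMap.norm_map_of_mem_unitary (U x).2]
  refine continuous_iff_continuousAt.2 fun y₀ => ?_
  have hlim : Filter.Tendsto (fun y => y₀⁻¹ * y) (𝓝 y₀) (𝓝 1) := by
    have := (continuous_const_mul y₀⁻¹).tendsto y₀
    rwa [inv_mul_cancel] at this
  refine tendsto_iff_norm_sub_tendsto_zero.2 (squeeze_zero (fun _ => norm_nonneg _) (fun y => ?_)
    ((tendsto_integral_norm_translate_sub μ f.continuous f.hasCompactSupport).comp hlim))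
  refine le_trans (le_of_eq ?_) (hbound (y₀⁻¹ * y))
  have h3 : (U y : H →L[ℂ] H) = U y₀ * U (y₀⁻¹ * y) := by
    rw [← Submonoid.coe_mul, ← map_mul, mul_inv_cancel_left]
  rw [h3, mul_assoc, ← mul_sub, CStarRing.norm_coe_unitary_mul]

end Smear

/-- If a strongly continuous unitary representation of a locally compact abelian group is nontrivial
at `g`, so is some continuous character. -/
theorem exists_pontryaginDual_apply_ne_one_of_unitary {G H : Type*} [CommGroup G]
    [TopologicalSpace G] [IsTopologicalGroup G] [LocallyCompactSpace G] [T2Space G]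
    [NormedAddCommGroup H] [InnerProductSpace ℂ H] [CompleteSpace H] (U : G →* unitary (H →L[ℂ] H))
    (hU : ∀ v, Continuous fun x => (U x : H →L[ℂ] H) v) {g : G} (hg : U g ≠ 1) :
    ∃ χ : PontryaginDual G, χ g ≠ 1 := by
  borelize G
  obtain ⟨v, hv⟩ : ∃ v, (U g : H →L[ℂ] H) v ≠ v := by
    by_contra! h
    exact hg (Subtype.ext (ContinuousLinearMap.ext h))
  set w := (U g : H →L[ℂ] H) v - v with hw
  have hw0 : w ≠ 0 := sub_ne_zero.2 hv
  have hUw : Continuous fun x => inner ℂ w ((U x : H →L[ℂ] H) w) :=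
    continuous_const.inner (hU w)
  obtain ⟨h, h1, -, hc, h0⟩ := exists_continuous_one_zero_of_isCompact
    (isCompact_singleton (x := (1 : G))) isClosed_empty (Set.disjoint_empty _)
  -- with this weight, `⟨w, a w⟩ = ∫ h(x) |⟨w, U(x) w⟩|² dx` for the smeared operator `a`
  let f : C_c(G, ℂ) := ⟨⟨fun x => (h x : ℂ) * star (inner ℂ w ((U x : H →L[ℂ] H) w)),
    (Complex.continuous_ofReal.comp h.continuous).mul hUw.star⟩,
    (hc.comp_left (g := fun x : ℝ => (x : ℂ)) (by simp)).mul_right⟩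
  let a := smear Measure.haar hU f
  have key : inner ℂ w (a w) =
      ((∫ x, h x * ‖inner ℂ w ((U x : H →L[ℂ] H) w)‖ ^ 2 ∂Measure.haar : ℝ) : ℂ) := by
    have h2 := (innerSL ℂ w).integral_comp_comm (integrable_smul_unitary Measure.haar hU f w)
    rw [← integral_complex_ofReal]
    refine h2.symm.trans (integral_congr_ae (Filter.Eventually.of_forall fun x => ?_))
    simp only [innerSL_apply_apply, inner_smul_right]
    change (h x : ℂ) * star _ * _ = _
    rw [mul_assoc, Complex.star_def, mul_comm (starRingEnd ℂ _), Complex.mul_conj,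
      Complex.normSq_eq_norm_sq]
    push_cast
    rfl
  have hpos : 0 < ∫ x, h x * ‖inner ℂ w ((U x : H →L[ℂ] H) w)‖ ^ 2 ∂Measure.haar := by
    refine Continuous.integral_pos_of_hasCompactSupport_nonneg_nonzero (x := 1)
      (h.continuous.mul (hUw.norm.pow 2)) hc.mul_right
      (fun x => mul_nonneg (h0 x).1 (by positivity)) ?_
    rw [h1 rfl]
    simpa using hw0
  have haw : a w ≠ 0 := fun h2 => by
    rw [h2, inner_zero_right] at key
    exact hpos.ne' (Complex.ofReal_eq_zero.1 key.symm)
  have := isStarNormal_smear Measure.haar hU f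
  refine exists_pontryaginDual_apply_ne_one_of_cstarAlgebra U a
    (fun x => commute_unitary_smear _ hU f x)
    (continuous_unitary_mul_smear _ hU f) (g := g) fun h2 => haw ?_
  have h3 : a ((U g : H →L[ℂ] H) v) = a v := by
    have h4 := (commute_unitary_smear Measure.haar hU f g).eq.symm.trans h2
    exact DFunLike.congr_fun h4 v
  rw [hw, map_sub, h3, sub_self]

/-- Continuous characters separate the points of a locally compact Hausdorff abelian group. -/
theorem exists_pontryaginDual_apply_ne_one {G : Type*} [CommGroup G] [TopologicalSpace G]
    [IsTopologicalGroup G] [LocallyCompactSpace G] [T2Space G] {g : G} (hg : g ≠ 1) :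
    ∃ χ : PontryaginDual G, χ g ≠ 1 := by
  borelize G
  set μ : Measure G := Measure.haar
  let L : G →* (Lp ℂ 2 μ ≃ₗᵢ[ℂ] Lp ℂ 2 μ) :=
    { toFun := fun x =>
        { toFun := fun v => DomMulAct.mk x • v
          invFun := fun v => DomMulAct.mk x⁻¹ • v
          left_inv := fun v => by
            dsimp only
            rw [smul_smul, ← DomMulAct.mk_mul, mul_inv_cancel, DomMulAct.mk_one, one_smul]
          right_inv := fun v => by
            dsimp only
            rw [smul_smul, ← DomMulAct.mk_mul, inv_mul_cancel, DomMulAct.mk_one, one_smul]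
          map_add' := fun v w => smul_add _ _ _
          map_smul' := fun c v => smul_comm _ _ _
          norm_map' := fun v => DomMulAct.norm_smul_Lp _ v }
      map_one' := LinearIsometryEquiv.ext fun v => one_smul Gᵈᵐᵃ v
      -- `DomMulAct` reverses the order of products, which does not matter as `G` is commutative
      map_mul' := fun x y => LinearIsometryEquiv.ext fun v => by
        change DomMulAct.mk (x * y) • v = DomMulAct.mk x • DomMulAct.mk y • v
        rw [smul_smul, ← DomMulAct.mk_mul, mul_comm] }
  refine exists_pontryaginDual_apply_ne_one_of_unitary
    (Unitary.linearIsometryEquiv.symm.toMonoidHom.comp L) (fun v => ?_) ?_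
  · have : Fact ((2 : ENNReal) ≠ ⊤) := ⟨by simp⟩
    change Continuous fun x => DomMulAct.mk x • v
    have h1 : Continuous fun x : G => DomMulAct.mk x := DomMulAct.continuous_mk
    exact h1.smul continuous_const
  · intro h
    have hL : L g = 1 := by
      have h2 : Unitary.linearIsometryEquiv.symm (L g) = 1 := h
      rwa [map_eq_one_iff _ (MulEquiv.injective _)] at h2
    obtain ⟨f, hf1, hfg, hfc, -⟩ := exists_continuous_one_zero_of_isCompact
      (isCompact_singleton (x := (1 : G))) (isClosed_singleton (x := g))
      (by simpa using Ne.symm hg)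
    let F : C_c(G, ℂ) := ⟨⟨fun x => (f x : ℂ), by fun_prop⟩,
      hfc.comp_left (g := fun x : ℝ => (x : ℂ)) (by simp)⟩
    have hF : MemLp F 2 μ := F.continuous.memLp_of_hasCompactSupport F.hasCompactSupport
    have h3 : DomMulAct.mk g • hF.toLp F = hF.toLp F := congrArg (fun e => e (hF.toLp F)) hL
    have h4 : (fun x => F (g * x)) =ᵐ[μ] F := by
      have h5 := DomMulAct.smul_Lp_ae_eq (DomMulAct.mk g) (hF.toLp F)
      rw [h3] at h5
      have h6 := (measurePreserving_mul_left μ g).quasiMeasurePreserving.ae_eq_comp hF.coeFn_toLp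
      exact h6.symm.trans (h5.symm.trans hF.coeFn_toLp)
    have h7 := (Continuous.ae_eq_iff_eq μ (by fun_prop) F.continuous).1 h4
    have h8 : (f (g * 1) : ℂ) = f 1 := congrFun h7 1
    rw [mul_one, hfg rfl, hf1 rfl] at h8
    simp at h8

end Characters

/-! ### Matrix entries of bounded operators -/

namespace KernelOperator

variable {ι : Type*}

open Classical in
/-- The entry `⟨δᵢ, T δⱼ⟩` of a bounded operator `T` on `ℓ²(ι)`. -/
noncomputable def matrixEntry (T : EllTwo ι →L[ℂ] EllTwo ι) (i j : ι) : ℂ := T (lp.single 2 j 1) i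

theorem norm_matrixEntry_le (T : EllTwo ι →L[ℂ] EllTwo ι) (i j : ι) :
    ‖matrixEntry T i j‖ ≤ ‖T‖ := by
  classical
  refine (lp.norm_apply_le_norm (by simp) _ i).trans ((T.le_opNorm _).trans ?_)
  rw [lp.norm_single (by simp), norm_one, mul_one]

theorem matrixEntry_sub (T T' : EllTwo ι →L[ℂ] EllTwo ι) (i j : ι) :
    matrixEntry (T - T') i j = matrixEntry T i j - matrixEntry T' i j := rfl

theorem continuous_matrixEntry (i j : ι) :
    Continuous fun T : EllTwo ι →L[ℂ] EllTwo ι => matrixEntry T i j := by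
  refine (LipschitzWith.of_dist_le_mul (K := 1) fun T T' => ?_).continuous
  rw [dist_eq_norm, dist_eq_norm, ← matrixEntry_sub, NNReal.coe_one, one_mul]
  exact norm_matrixEntry_le _ i j

theorem ext_matrixEntry {T T' : EllTwo ι →L[ℂ] EllTwo ι}
    (h : ∀ i j, matrixEntry T i j = matrixEntry T' i j) : T = T' := by
  classical
  refine ContinuousLinearMap.ext fun v => ?_
  have hv := lp.hasSum_single (p := 2) (by simp) v
  refine (hv.mapL T).unique ?_
  convert hv.mapL T' using 2 with j
  have h1 : lp.single 2 j (v j) = v j • lp.single (E := fun _ : ι => ℂ) 2 j (1 : ℂ) := by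
    rw [← lp.single_smul, smul_eq_mul, mul_one]
  rw [h1, map_smul, map_smul]
  congr 1
  refine lp.ext (funext fun i => ?_)
  have h2 := h i j
  simp only [matrixEntry] at h2
  convert! h2

theorem matrixEntry_ofKernel {k : ι → ι → ℂ} (hk : IsBanded k) (i j : ι) :
    matrixEntry (ofKernel k hk) i j = k i j := by
  classical
  rw [matrixEntry, ofKernel_apply, tsum_eq_single j]
  · rw [lp.single_apply_self, mul_one]
  · intro q hq
    rw [lp.single_apply_ne _ _ _ hq, mul_zero]

theorem matrixEntry_mulOp_mul_mul_mulOp {a b : ι → ℂ} (ha : ∃ C : ℝ, ∀ i, ‖a i‖ ≤ C)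
    (hb : ∃ C : ℝ, ∀ i, ‖b i‖ ≤ C) (T : EllTwo ι →L[ℂ] EllTwo ι) (i j : ι) :
    matrixEntry (mulOp a ha * T * mulOp b hb) i j = a i * matrixEntry T i j * b j := by
  classical
  change mulOp a ha (T (mulOp b hb (lp.single 2 j 1))) i = _
  have h1 : mulOp b hb (lp.single 2 j 1) = b j • lp.single (E := fun _ : ι => ℂ) 2 j (1 : ℂ) := by
    refine lp.ext (funext fun q => ?_)
    rw [mulOp_apply, lp.coeFn_smul, Pi.smul_apply, smul_eq_mul]
    by_cases hq : q = j
    · rw [hq]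
    · rw [lp.single_apply_ne _ _ _ hq, mul_zero, mul_zero]
  rw [mulOp_apply, h1, map_smul, lp.coeFn_smul, Pi.smul_apply, smul_eq_mul, matrixEntry]
  ring

end KernelOperator

/-! ### Matrix entries of elements of the groupoid C*-algebra -/

namespace DeaconuRenaultSystem

open Groupoid KernelOperator

variable {X : Type*} [TopologicalSpace X] [LocallyCompactSpace X] [T2Space X]
  {S : DeaconuRenaultSystem X}

theorem matrixEntry_regRep (ξ : C_c(S.Groupoid, ℂ)) (g h : S.Groupoid) :
    matrixEntry (regRep S ξ) g h = regKernel ξ g h :=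
  matrixEntry_ofKernel (isBanded_regKernel ξ) _ _

theorem matrixEntry_eq_zero_of_src_ne {T : EllTwo S.Groupoid →L[ℂ] EllTwo S.Groupoid}
    (hT : T ∈ S.cstarAlgebra) {g h : S.Groupoid} (hs : g.src ≠ h.src) :
    matrixEntry T g h = 0 := by
  have hcl : IsClosed {T : EllTwo S.Groupoid →L[ℂ] EllTwo S.Groupoid | matrixEntry T g h = 0} :=
    isClosed_eq (continuous_matrixEntry g h) continuous_const
  refine closure_minimal ?_ hcl hT
  rintro _ ⟨ξ, rfl⟩
  exact (matrixEntry_regRep ξ g h).trans (regKernel_of_ne _ hs)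

/-- The entries `(g, h)` and `(g', h')` of an element of `C*(𝒢)` agree if `g h⁻¹ = g' h'⁻¹`, as its
entries are the values at `g h⁻¹` of a function on `𝒢`. -/
theorem matrixEntry_eq_of_mulInv_eq {T : EllTwo S.Groupoid →L[ℂ] EllTwo S.Groupoid}
    (hT : T ∈ S.cstarAlgebra) {g h g' h' : S.Groupoid} (hs : g.src = h.src) (hs' : g'.src = h'.src)
    (he : g.mulInv h hs = g'.mulInv h' hs') : matrixEntry T g h = matrixEntry T g' h' := by
  have hcl : IsClosed {T : EllTwo S.Groupoid →L[ℂ] EllTwo S.Groupoid |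
      matrixEntry T g h = matrixEntry T g' h'} :=
    isClosed_eq (continuous_matrixEntry g h) (continuous_matrixEntry g' h')
  refine closure_minimal ?_ hcl hT
  rintro _ ⟨ξ, rfl⟩
  change matrixEntry (regRep S ξ) g h = matrixEntry (regRep S ξ) g' h'
  rw [matrixEntry_regRep, matrixEntry_regRep, regKernel_of_eq _ hs, regKernel_of_eq _ hs', he]

theorem Groupoid.mulInv_self (g : S.Groupoid) : g.mulInv g rfl = unit g.rng := by
  ext <;> simp [mulInv, comp, inv, unit]

theorem Groupoid.eq_of_mulInv_eq_unit {g h : S.Groupoid} (hs : g.src = h.src)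
    (hu : g.mulInv h hs = unit g.rng) : g = h := by
  refine Groupoid.ext (congrArg Groupoid.src hu).symm ?_ hs
  have := congrArg Groupoid.deg hu
  simp only [mulInv, comp, inv, unit] at this
  omega

/-- The restriction of an element of `C*(𝒢)` to the unit space lies in `C₀(X)`: it is a uniform
limit of restrictions of functions in `C_c(𝒢)`. -/
theorem exists_zeroAtInfty_diagonalEntry {T : EllTwo S.Groupoid →L[ℂ] EllTwo S.Groupoid}
    (hT : T ∈ S.cstarAlgebra) :
    ∃ F : C₀(X, ℂ), ∀ x, F x = matrixEntry T (unit x) (unit x) := by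
  have happrox : ∀ ε > 0, ∃ ξ : C_c(S.Groupoid, ℂ),
      ∀ x, ‖matrixEntry T (unit x) (unit x) - ξ (unit x)‖ < ε := fun ε hε => by
    obtain ⟨_, ⟨ξ, rfl⟩, hξ⟩ := Metric.mem_closure_iff.1 hT ε hε
    refine ⟨ξ, fun x => ?_⟩
    have h1 : matrixEntry (regRep S ξ) (unit x) (unit x) = ξ (unit x) := by
      rw [matrixEntry_regRep, regKernel_of_eq _ rfl, mulInv_self]
      rfl
    rw [← h1, ← matrixEntry_sub]
    exact (norm_matrixEntry_le _ _ _).trans_lt (by rwa [← dist_eq_norm])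
  refine ⟨⟨⟨fun x => matrixEntry T (unit x) (unit x), ?_⟩, ?_⟩, fun x => rfl⟩
  · refine continuous_of_uniform_approx_of_continuous fun u hu => ?_
    obtain ⟨ε, hε, hu⟩ := Metric.mem_uniformity_dist.1 hu
    obtain ⟨ξ, hξ⟩ := happrox ε hε
    exact ⟨fun x => ξ (unit x), ξ.continuous.comp continuous_unit, fun x =>
      hu (by rw [dist_eq_norm]; exact hξ x)⟩
  · refine Metric.tendsto_nhds.2 fun ε hε => ?_
    obtain ⟨ξ, hξ⟩ := happrox ε hε
    filter_upwards [(ξ.hasCompactSupport.isCompact.image continuous_rng).compl_mem_cocompact]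
      with x hx
    have h0 : ξ (unit x) = 0 := image_eq_zero_of_notMem_tsupport fun h => hx ⟨_, h, rfl⟩
    simpa [h0] using hξ x

theorem matrixEntry_diagonal (F : C₀(X, ℂ)) (g h : S.Groupoid) :
    matrixEntry (S.diagonal F : EllTwo S.Groupoid →L[ℂ] EllTwo S.Groupoid) g h =
      diagKernel (fun g => F g.rng) g h :=
  matrixEntry_ofKernel (isBanded_diagKernel (exists_bound_comp_rng F)) g h

/-! ### Orbit segments -/

/-- An orbit segment is determined by its endpoint and the multiset of the points it visits before
the endpoint. Listing the points `z, σ z, …, σᵏ z` from either end gives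
`{σᵏ z} + M = {z} + σ(M)` for the multiset `M` of the first `k` points of the orbit of `z`; so the
endpoint and `M` determine `z`. -/
theorem eq_of_map_iterate_range_eq {α : Type*} (σ : α → α) {m n : ℕ} {x y : α}
    (h : σ^[m] x = σ^[n] y) (hM : (Multiset.range m).map (fun i => σ^[i] x) =
      (Multiset.range n).map (fun j => σ^[j] y)) : m = n ∧ x = y := by
  have hmn : m = n := by simpa using congrArg Multiset.card hM
  refine ⟨hmn, ?_⟩
  have key : ∀ (k : ℕ) (z : α), (σ^[k] z) ::ₘ (Multiset.range k).map (fun i => σ^[i] z) =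
      z ::ₘ ((Multiset.range k).map (fun i => σ^[i] z)).map σ := fun k z => by
    induction k with
    | zero => simp
    | succ k ih =>
      rw [Multiset.range_succ, Multiset.map_cons, Multiset.map_cons, Multiset.cons_swap z, ← ih,
        ← Function.iterate_succ_apply' σ]
  have h1 := key m x
  rw [hM, h, key n y] at h1
  exact ((Multiset.cons_inj_left _).1 h1).symm

/-! ### Cocycles and the weighted actions -/

section Weighted

variable {Γ : Type*} [CommGroup Γ] [TopologicalSpace Γ]

/-- Continuous `Γ`-valued functions detect the units. Write `c_f(x, m - n, y)` as a product over `X`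
of the values of `f`, with exponents the difference of the numbers of visits of the two orbit
segments. If some exponent is nonzero, a function whose value there has infinite order and which is
trivial at the other visited points has `c_f ≠ 1`; if all are zero, then `m = n` and `x = y`. -/
theorem eq_unit_of_forall_cocycle_eq_one (hΓ : IsSeparating Γ X) {g : S.Groupoid}
    (hg : ∀ f : C(X, Γ), cocycle f g = 1) : g = unit g.rng := by
  classical
  obtain ⟨m, n, hd, ht⟩ := g.exists_tailEq
  set M := (Multiset.range m).map (fun i => S.σ^[i] g.rng) with hMdef
  set N := (Multiset.range n).map (fun j => S.σ^[j] g.src) with hNdef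
  by_cases hMN : M = N
  · obtain ⟨rfl, he⟩ := eq_of_map_iterate_range_eq S.σ ht.2.2 hMN
    exact Groupoid.ext rfl (by rw [hd, sub_self]; rfl) he.symm
  · exfalso
    obtain ⟨z, hz⟩ : ∃ z, M.count z ≠ N.count z := by
      by_contra! h
      exact hMN (Multiset.ext.2 h)
    obtain ⟨f, hfz, hf⟩ := hΓ ((M + N).toFinset.erase z) z (by simp)
    have hM : S.iterProd f m g.rng = f z ^ M.count z := by
      rw [← Multiset.prod_map_eq_pow_single (f := ⇑f) z fun w hw hwM =>
        hf w (by simp [hw, hwM]), hMdef, Multiset.map_map]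
      rfl
    have hN : S.iterProd f n g.src = f z ^ N.count z := by
      rw [← Multiset.prod_map_eq_pow_single (f := ⇑f) z fun w hw hwN =>
        hf w (by simp [hw, hwN]), hNdef, Multiset.map_map]
      rfl
    have h1 := hg f
    rw [cocycle_eq f hd ht, hM, hN, div_eq_one] at h1
    exact hz (injective_pow_iff_not_isOfFinOrder.2 hfz h1)

variable [IsTopologicalGroup Γ]

theorem coe_weightedAction (f : C(X, Γ)) (χ : PontryaginDual Γ) (a : S.cstarAlgebra) :
    (S.weightedAction f χ a : EllTwo S.Groupoid →L[ℂ] EllTwo S.Groupoid) =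
      mulOp (weight f χ) (exists_bound_weight f χ) *
        (a : EllTwo S.Groupoid →L[ℂ] EllTwo S.Groupoid) *
        mulOp (weight f χ⁻¹) (exists_bound_weight f χ⁻¹) := by
  have hs : star (mulOp (weight (S := S) f χ) (exists_bound_weight f χ)) =
      mulOp (weight f χ⁻¹) (exists_bound_weight f χ⁻¹) :=
    star_mulOp _ (exists_bound_weight f χ⁻¹) fun g => Circle.coe_inv_eq_conj _
  rw [← hs]
  exact Unitary.conjStarAlgAut_apply _ _

/-- The weighted action multiplies the entry at `(g, h)` by `χ(c_f(g) / c_f(h))`. -/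
theorem matrixEntry_weightedAction (f : C(X, Γ)) (χ : PontryaginDual Γ) (a : S.cstarAlgebra)
    (g h : S.Groupoid) :
    matrixEntry (S.weightedAction f χ a : EllTwo S.Groupoid →L[ℂ] EllTwo S.Groupoid) g h =
      (χ (cocycle f g / cocycle f h) : Circle) *
        matrixEntry (a : EllTwo S.Groupoid →L[ℂ] EllTwo S.Groupoid) g h := by
  rw [coe_weightedAction, matrixEntry_mulOp_mul_mul_mulOp, map_div, div_eq_mul_inv,
    Circle.coe_mul, mul_right_comm]
  rfl

end Weighted

end DeaconuRenaultSystem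

open DeaconuRenaultSystem DeaconuRenaultSystem.Groupoid KernelOperator in
theorem lemma3p8 {X : Type*} [TopologicalSpace X] [LocallyCompactSpace X] [T2Space X]
    (S : DeaconuRenaultSystem X)
    {Γ : Type*} [CommGroup Γ] [TopologicalSpace Γ] [IsTopologicalGroup Γ]
    [LocallyCompactSpace Γ] [T2Space Γ] (hΓ : IsSeparating Γ X) :
    Set.range S.diagonal = ⋂ f : C(X, Γ), S.fixedPoints f := by
  refine Set.Subset.antisymm ?_ fun a ha => ?_
  · rintro _ ⟨F, rfl⟩
    refine Set.mem_iInter.2 fun f χ => Subtype.ext (ext_matrixEntry fun g h => ?_)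
    rw [matrixEntry_weightedAction]
    by_cases hgh : g = h
    · rw [hgh, div_self', map_one, Circle.coe_one, one_mul]
    · have h0 : matrixEntry (S.diagonal F : EllTwo S.Groupoid →L[ℂ] EllTwo S.Groupoid) g h = 0 :=
        (matrixEntry_diagonal F g h).trans (if_neg hgh)
      rw [h0, mul_zero]
  · obtain ⟨F, hF⟩ := exists_zeroAtInfty_diagonalEntry a.2
    refine ⟨F, Subtype.ext (ext_matrixEntry fun g h => ?_)⟩
    refine (matrixEntry_diagonal F g h).trans ?_
    unfold diagKernel
    split_ifs with hgh
    · subst hgh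
      refine (hF _).trans ?_
      exact matrixEntry_eq_of_mulInv_eq a.2 rfl rfl (by rw [mulInv_self, mulInv_self]; rfl)
    · by_contra hne
      have hne := Ne.symm hne
      have hs : g.src = h.src := by
        by_contra hs
        exact hne (matrixEntry_eq_zero_of_src_ne a.2 hs)
      refine hgh (eq_of_mulInv_eq_unit hs (eq_unit_of_forall_cocycle_eq_one hΓ fun f => ?_))
      -- otherwise a character of `Γ` detects the cocycle, and the fixed entry must vanish
      by_contra hc
      obtain ⟨χ, hχ⟩ := exists_pontryaginDual_apply_ne_one hc
      have h1 := matrixEntry_weightedAction f χ a g h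
      rw [Set.mem_iInter.1 ha f χ] at h1
      have h2 := (mul_eq_right₀ hne).1 h1.symm
      refine hχ ?_
      rw [mulInv, cocycle_comp, cocycle_inv, ← div_eq_mul_inv]
      exact Circle.coe_eq_one.1 h2
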